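/- **Setting.** Let $1\le N\le d$ be integers, let $\lambda=(\lambda_1\ge\dots\ge\lambda_N\ge0)$ be a partition with $\lambda_1\le d-N$, and put $n=|\lambda|$, $d_i=\lambda_i+N-i$, $P=\{d_1,\dots,d_N\}$. Let $\mathcal O_\lambda=\mathbb C[f_{ij}]$ be the polynomial algebra in the variables $f_{ij}$ with $1\le i\le N$, $1\le j\le d_i$, $d_i-j\notin P$, and let $f_i(u)=u^{d_i}+\sum_{j}f_{ij}u^{d_i-j}\in\mathcal O_\lambda[u]$. Let $\Lambda=(\lambda^{(1)},\dots,\lambda^{(k)})$ be partitions with at most $N$ parts, $n_s=|\lambda^{(s)}|$, $\sum_s n_s=n$, and let $b=(b_1,\dots,b_k)$ be distinct complex numbers. Put $e^{(s)}_j=\lambda^{(s)}_j+N-j$. **The intersection.** Let $\mathbb C_m[u]$ be the space of polynomials of degree less than $m$. For a complete flag $F_1\subset\dots\subset F_d=\mathbb C_d[u]$ (with $F_0=0$) and a partition $\mu$ with at most $N$ parts and $\mu_1\le d-N$, the Schubert cell $\Omega_\mu(F)$ is the set of $N$-dimensional subspaces $X\subset\mathbb C_d[u]$ with $\dim(X\cap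 F_{d-N+j-\mu_j})=j$ and $\dim(X\cap F_{d-N+j-\mu_j-1})=j-1$ for $j=1,\dots,N$; if $\mu_1>d-N$, put $\Omega_\mu(F)=\emptyset$. Let $\Omega_\mu(b)$ be the cell for the flag $F_m=(u-b)^{d-m}\mathbb C_m[u]$ and $\Omega_\mu(\infty)$ the cell for $F_m=\mathbb C_m[u]$. With $\bar\lambda=(d-N-\lambda_N,\dots,d-N-\lambda_1)$, the cell $\Omega_{\bar\lambda}(\infty)$ is the affine space with coordinates $f_{ij}$: the point with coordinates $x$ is the span of the specializations of $f_1(u),\dots,f_N(u)$ at $x$. Put $$\Omega=\Omega_{\bar\lambda}(\infty)\cap\bigcap_{s=1}^k\Omega_{\lambda^{(s)}}(b_s).$$ **The algebra $\mathcal O_{\Lambda,\lambda,b}$.** Let $\mathcal Q$ be the subring of the field of fractions of $\mathcal O_\lambda$ consisting of the elements regular at all points of $\Omega$. Let $M_s$ be the $N\times N$ matrix over $\mathcal O_\lambda$ with entries $(M_s)_{ij}=\frac{1}{e^{(s)}_j!}\,f_i^{(e^{(s)}_j)}(b_s)$. If all $M_s$ are invertible over $\mathcal Q$, define $g_{ijs}\in\mathcal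 Q$ by $\sum_j g_{ijs}(u-b_s)^j=\sum_{m=1}^N(M_s^{-1})_{im}f_m(u)$, let $J$ be the ideal of $\mathcal Q$ generated by all $g_{ijs}$ with $1\le i\le N$, $1\le s\le k$, $0\le j<e^{(s)}_i$ (where $g_{ijs}=0$ for $j>d_1$), and put $\mathcal O_{\Lambda,\lambda,b}=\mathcal Q/J$. **The ideal $I$.** Let $\partial=d/du$ and let $G_0(u),\dots,G_N(u)\in\mathcal O_\lambda[u]$ be defined by $$\operatorname{rdet}\begin{pmatrix}f_1&f_1'&\cdots&f_1^{(N)}\\ \vdots&\vdots&&\vdots\\ f_N&f_N'&\cdots&f_N^{(N)}\\ 1&\partial&\cdots&\partial^N\end{pmatrix}=\sum_{i=0}^N G_i(u)\,\partial^{N-i},$$ where $\operatorname{rdet}(a_{ij})=\sum_\sigma \operatorname{sgn}(\sigma)\,a_{1\sigma(1)}a_{2\sigma(2)}\cdots$. Write $G_i(u)=\sum_{j\ge0}G_{ijs}(u-b_s)^j$ and put $G_{ijs}=0$ for $j<0$. Let $$\chi_s(\alpha)=\sum_{i=0}^N G_{i,n_s-i,s}\prod_{j=0}^{N-i-1}(\alpha-j)\in\mathcal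 O_\lambda[\alpha].$$ Let $I$ be the ideal of $\mathcal O_\lambda$ generated by all $G_{ijs}$ with $0\le i\le N$, $1\le s\le k$, $0\le j\le n_s-i-1$, and by the coefficients of the polynomials in $\alpha$ $$\chi_s(\alpha)-\prod_{1\le i<j\le N}(d_j-d_i)\ \prod_{r\ne s}(b_s-b_r)^{n_r}\ \prod_{l=1}^N(\alpha-\lambda^{(s)}_l-N+l),\qquad s=1,\dots,k.$$ **Proposition.** If $\Omega\neq\emptyset$, then $M_1,\dots,M_k$ are invertible over $\mathcal Q$, so that $\mathcal O_{\Lambda,\lambda,b}$ is defined, and $\mathcal O_{\Lambda,\lambda,b}$ is isomorphic to $\mathcal O_\lambda/I$ as a $\mathbb C$-algebra. If $\Omega=\emptyset$, then $\mathcal O_\lambda/I=0$, and $\mathcal O_{\Lambda,\lambda,b}\cong\mathcal O_\lambda/I$ as $\mathbb C$-algebras whenever all $M_s$ are invertible over $\mathcal Q$. -/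

import Mathlib

open Polynomial

noncomputable section

namespace SchubertIntersection

/-! ## The Schubert cell at infinity and its coordinate ring

A partition with at most `N` parts is an antitone function `Fin N → ℕ`; the `i`-th part of the
mathematical text is the value at the index `i - 1`. -/

/-- The number `d_i = μ_i + N - i` (in zero-based indexing `μ i + (N - 1 - i)`). -/
def expo {N : ℕ} (mu : Fin N → ℕ) (i : Fin N) : ℕ := mu i + (N - 1 - (i : ℕ))

/-- The indices `(i, j)` of the coordinates `f_ij`: `1 ≤ j ≤ d_i` and
`d_i - j ∉ P = {d_1, …, d_N}`. -/
def CoordIdx {N : ℕ} (lam : Fin N → ℕ) : Type :=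
  {p : Fin N × ℕ // 1 ≤ p.2 ∧ p.2 ≤ expo lam p.1 ∧ ∀ l, expo lam l ≠ expo lam p.1 - p.2}

/-- The polynomial algebra `O_λ = ℂ[f_ij]`. -/
abbrev Olam {N : ℕ} (lam : Fin N → ℕ) : Type := MvPolynomial (CoordIdx lam) ℂ

/-- The generating function `f_i(u) = u^{d_i} + ∑_j f_ij u^{d_i - j}`. -/
def genF {N : ℕ} (lam : Fin N → ℕ) (i : Fin N) : (Olam lam)[X] :=
  X ^ expo lam i + ∑ j ∈ Finset.Icc 1 (expo lam i),
    if h : 1 ≤ j ∧ j ≤ expo lam i ∧ ∀ l, expo lam l ≠ expo lam i - j then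
      C (MvPolynomial.X (⟨(i, j), h⟩ : CoordIdx lam)) * X ^ (expo lam i - j)
    else 0

/-- The space of polynomials `X = ⟨f_1(u), …, f_N(u)⟩` with coordinates `x = (f_ij)`. -/
def spaceAt {N : ℕ} (lam : Fin N → ℕ) (x : CoordIdx lam → ℂ) : Submodule ℂ ℂ[X] :=
  Submodule.span ℂ (Set.range fun i => (genF lam i).map (MvPolynomial.eval x))

/-! ## Schubert cells -/

/-- The flag `F(∞)`: its `m`-th term is `ℂ_m[u]`, the polynomials of degree less than `m`. -/
def flagInfty (m : ℕ) : Submodule ℂ ℂ[X] := degreeLT ℂ m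

/-- The flag `F(b)` in `ℂ_d[u]`: its `m`-th term (`m ≤ d`) is `(u - b)^{d - m} ℂ_m[u]`. -/
def flagAt (d : ℕ) (b : ℂ) (m : ℕ) : Submodule ℂ ℂ[X] :=
  (degreeLT ℂ m).map (LinearMap.mulLeft ℂ ((X - C b) ^ (d - m)))

/-- The Schubert cell `Ω_μ(F)` in the Grassmannian of `N`-dimensional subspaces of `ℂ_d[u]`:
`dim (X ∩ F_{d-N+j-μ_j}) = j` and `dim (X ∩ F_{d-N+j-μ_j-1}) = j - 1` for `j = 1, …, N`.
It is empty if `μ_1 > d - N`. -/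
def schubertCell (N d : ℕ) (F : ℕ → Submodule ℂ ℂ[X]) (mu : Fin N → ℕ) :
    Set (Submodule ℂ ℂ[X]) :=
  {V | V ≤ degreeLT ℂ d ∧ Module.finrank ℂ V = N ∧ ∀ j : Fin N,
    Module.finrank ℂ (V ⊓ F (d - N + (j + 1) - mu j) : Submodule ℂ ℂ[X]) = j + 1 ∧
    Module.finrank ℂ (V ⊓ F (d - N + (j + 1) - mu j - 1) : Submodule ℂ ℂ[X]) = j}

/-- The dual partition `(d - N - λ_N, …, d - N - λ_1)`. -/
def dualPartition {N : ℕ} (d : ℕ) (lam : Fin N → ℕ) (i : Fin N) : ℕ := d - N - lam i.rev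

/-- The intersection of the Schubert cell at infinity of the dual partition of `λ` with the
cells of `λ^(s)` at `b_s`, as a set of points of the Grassmannian. -/
def cellIntersection {N k : ℕ} (d : ℕ) (lam : Fin N → ℕ) (Lam : Fin k → Fin N → ℕ)
    (b : Fin k → ℂ) : Set (Submodule ℂ ℂ[X]) :=
  schubertCell N d flagInfty (dualPartition d lam) ∩
    ⋂ s, schubertCell N d (flagAt d (b s)) (Lam s)

/-- The same intersection in the coordinates `f_ij` of the cell at infinity. -/
def Omega {N k : ℕ} (d : ℕ) (lam : Fin N → ℕ) (Lam : Fin k → Fin N → ℕ)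
    (b : Fin k → ℂ) : Set (CoordIdx lam → ℂ) :=
  {x | spaceAt lam x ∈ cellIntersection d lam Lam b}

/-! ## The algebra of functions on the intersection -/

/-- The field of fractions of `O_λ`. -/
abbrev Qlam {N : ℕ} (lam : Fin N → ℕ) : Type := FractionRing (Olam lam)

/-- A rational function is regular at `x` if it is a fraction whose denominator does not vanish
at `x`. -/
def RegularAt {N : ℕ} {lam : Fin N → ℕ} (x : CoordIdx lam → ℂ) (y : Qlam lam) : Prop :=
  ∃ p q : Olam lam, MvPolynomial.eval x q ≠ 0 ∧
    y * algebraMap (Olam lam) (Qlam lam) q = algebraMap (Olam lam) (Qlam lam) p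

/-- The subring of the field of fractions of `O_λ` formed by the rational functions that are
regular at every point of the intersection of the cells. -/
def QLam {N k : ℕ} (d : ℕ) (lam : Fin N → ℕ) (Lam : Fin k → Fin N → ℕ) (b : Fin k → ℂ) :
    Subalgebra (Olam lam) (Qlam lam) where
  carrier := {y | ∀ x ∈ Omega d lam Lam b, RegularAt x y}
  mul_mem' := by
    intro y z hy hz x hx
    obtain ⟨p, q, hq, h⟩ := hy x hx
    obtain ⟨p', q', hq', h'⟩ := hz x hx
    refine ⟨p * p', q * q', by simpa using ⟨hq, hq'⟩, ?_⟩
    rw [map_mul, map_mul, ← h, ← h']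
    ring
  add_mem' := by
    intro y z hy hz x hx
    obtain ⟨p, q, hq, h⟩ := hy x hx
    obtain ⟨p', q', hq', h'⟩ := hz x hx
    refine ⟨p * q' + p' * q, q * q', by simpa using ⟨hq, hq'⟩, ?_⟩
    rw [map_add, map_mul, map_mul, map_mul, ← h, ← h']
    ring
  algebraMap_mem' := by
    intro r x _
    exact ⟨r, 1, by simp, by simp⟩

/-- The matrix `M_s` over `O_λ`, with `(i, j)` entry `f_i^{(e)}(b_s) / e!`, where
`e = λ^(s)_j + N - j`. -/
def matM {N k : ℕ} (lam : Fin N → ℕ) (Lam : Fin k → Fin N → ℕ) (b : Fin k → ℂ) (s : Fin k) :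
    Matrix (Fin N) (Fin N) (Olam lam) :=
  Matrix.of fun i j =>
    MvPolynomial.C ((Nat.factorial (expo (Lam s) j) : ℂ)⁻¹) *
      (derivative^[expo (Lam s) j] (genF lam i)).eval (MvPolynomial.C (b s))

/-- The matrix `M_s` with entries considered in the ring `QLam`. -/
def matMQ {N k : ℕ} (d : ℕ) (lam : Fin N → ℕ) (Lam : Fin k → Fin N → ℕ) (b : Fin k → ℂ)
    (s : Fin k) : Matrix (Fin N) (Fin N) (QLam d lam Lam b) :=
  (matM lam Lam b s).map (algebraMap (Olam lam) (QLam d lam Lam b))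

/-- The polynomial `g_is(u) = ∑_m (M_s⁻¹)_im f_m(u)`. -/
def gPoly {N k : ℕ} (d : ℕ) (lam : Fin N → ℕ) (Lam : Fin k → Fin N → ℕ) (b : Fin k → ℂ)
    (s : Fin k) (i : Fin N) : (QLam d lam Lam b)[X] :=
  ∑ m, C ((matMQ d lam Lam b s)⁻¹ i m) *
    (genF lam m).map (algebraMap (Olam lam) (QLam d lam Lam b))

/-- The elements `g_ijs` given by `∑_j g_ijs (u - b_s)^j = g_is(u)`. -/
def gCoeff {N k : ℕ} (d : ℕ) (lam : Fin N → ℕ) (Lam : Fin k → Fin N → ℕ) (b : Fin k → ℂ)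
    (s : Fin k) (i : Fin N) (j : ℕ) : QLam d lam Lam b :=
  (taylor (algebraMap ℂ (QLam d lam Lam b) (b s)) (gPoly d lam Lam b s i)).coeff j

/-- The ideal `J^s`, generated by the `g_ijs` with `j < λ^(s)_i + N - i`. -/
def idealJs {N k : ℕ} (d : ℕ) (lam : Fin N → ℕ) (Lam : Fin k → Fin N → ℕ) (b : Fin k → ℂ)
    (s : Fin k) : Ideal (QLam d lam Lam b) :=
  Ideal.span {y | ∃ (i : Fin N) (j : ℕ), j < expo (Lam s) i ∧ y = gCoeff d lam Lam b s i j}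

/-- The ideal `J = ∑_s J^s`. -/
def idealJ {N k : ℕ} (d : ℕ) (lam : Fin N → ℕ) (Lam : Fin k → Fin N → ℕ) (b : Fin k → ℂ) :
    Ideal (QLam d lam Lam b) :=
  ⨆ s, idealJs d lam Lam b s

/-- The algebra of functions on the (scheme-theoretic) intersection of the Schubert cells. -/
abbrev OLam {N k : ℕ} (d : ℕ) (lam : Fin N → ℕ) (Lam : Fin k → Fin N → ℕ) (b : Fin k → ℂ) :
    Type :=
  QLam d lam Lam b ⧸ idealJ d lam Lam b

/-! ## The differential operator and its coefficients -/

/-- The row determinant of a square matrix with possibly noncommuting entries. -/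
def rdet {R : Type*} [Ring R] {m : ℕ} (A : Matrix (Fin m) (Fin m) R) : R :=
  ∑ σ : Equiv.Perm (Fin m),
    ((Equiv.Perm.sign σ : ℤˣ) : ℤ) • (List.ofFn fun i => A i (σ i)).prod

/-- The differential operator `rdet` of the matrix with rows `f_i, f_i', …, f_i^{(N)}` for
`i = 1, …, N` and last row `1, ∂, …, ∂^N`, acting on `A[u]`; it is used for
the generating functions `f_i(u)` over `A = O_λ`. -/
def opD {A : Type*} [CommRing A] {N : ℕ} (f : Fin N → A[X]) : Module.End A A[X] :=
  rdet (Matrix.of fun (r c : Fin (N + 1)) =>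
    Fin.lastCases (motive := fun _ => Module.End A A[X])
      (derivative ^ (c : ℕ))
      (fun i => LinearMap.mulLeft A (derivative^[c] (f i))) r)

/-- The coefficient `G_i(u)` of `∂^{N-i}` in the operator: `(-1)^i` times the minor of the first
`N` rows that omits the column of `∂^{N-i}` (see `opD_eq`). -/
def polyG {A : Type*} [CommRing A] {N : ℕ} (f : Fin N → A[X]) (i : Fin (N + 1)) : A[X] :=
  (-1) ^ (i : ℕ) * Matrix.det (Matrix.of fun (a c : Fin N) =>
    derivative^[(i.rev.succAbove c : Fin (N + 1))] (f a))

/-- Sending `∑ a_m y^m` to `∑ a_m ∂^m` (normal ordering of symbols). -/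
def symOp {A : Type*} [CommRing A] : A[X][X] →+ Module.End A A[X] where
  toFun p := p.sum fun m a => LinearMap.mulLeft A a * derivative ^ m
  map_zero' := by simp
  map_add' p q := by
    apply Polynomial.sum_add_index
    · intro m; ext; simp
    · intro m a b; ext; simp [add_mul]

theorem symOp_C_mul_X_pow {A : Type*} [CommRing A] (a : A[X]) (m : ℕ) :
    symOp (C a * X ^ m) = LinearMap.mulLeft A a * derivative ^ m := by
  have h : LinearMap.mulLeft A (0 : A[X]) * derivative ^ m = 0 := by ext; simp
  rw [C_mul_X_pow_eq_monomial]
  exact Polynomial.sum_monomial_index a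
    (fun m a => LinearMap.mulLeft A a * derivative ^ m) h

theorem neg_one_pow_aux (R : Type*) [CommRing R] {N i : ℕ} (hi : i ≤ N) :
    (-1 : R) ^ (N + (N - i)) = (-1) ^ i := by
  obtain ⟨t, ht⟩ := Nat.exists_eq_add_of_le hi
  have : N + (N - i) = i + 2 * t := by omega
  rw [this, pow_add, pow_mul, neg_one_sq, one_pow, mul_one]

/-- The row determinant is the operator `∑_i G_i(u) ∂^{N-i}`. -/
theorem opD_eq {A : Type*} [CommRing A] {N : ℕ} (f : Fin N → A[X]) :
    opD f = ∑ i : Fin (N + 1),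
      LinearMap.mulLeft A (polyG f i) * derivative ^ (N - (i : ℕ)) := by
  set S : Matrix (Fin (N + 1)) (Fin (N + 1)) A[X][X] :=
    Matrix.of fun r c => Fin.lastCases (motive := fun _ => A[X][X])
      (X ^ (c : ℕ)) (fun i => C (derivative^[c] (f i))) r with hS
  have h1 : opD f = symOp S.det := by
    rw [← Matrix.det_transpose, Matrix.det_apply, map_sum]
    unfold opD rdet
    refine Finset.sum_congr rfl fun σ _ => ?_
    rw [Units.smul_def, map_zsmul]
    congr 1
    rw [List.ofFn_succ', List.prod_concat, Fin.prod_univ_castSucc]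
    simp only [Matrix.of_apply, Fin.lastCases_castSucc, Fin.lastCases_last,
      Matrix.transpose_apply, hS]
    rw [← map_prod, symOp_C_mul_X_pow]
    congr 1
    have key : ∀ a : Fin N → A[X],
        (List.ofFn fun i => LinearMap.mulLeft A (a i)).prod =
          LinearMap.mulLeft A (∏ i, a i) := by
      intro a
      rw [← List.prod_ofFn]
      have := map_list_prod (Algebra.lmul A A[X]) (List.ofFn a)
      rw [List.map_ofFn] at this
      exact this.symm
    exact key _
  have h2 : S.det = ∑ i : Fin (N + 1), C (polyG f i) * X ^ (N - (i : ℕ)) := by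
    rw [Matrix.det_succ_row S (Fin.last N), ← Equiv.sum_comp Fin.revPerm]
    refine Finset.sum_congr rfl fun i _ => ?_
    have hi : (i : ℕ) ≤ N := by omega
    have hr : ((i.rev : Fin (N + 1)) : ℕ) = N - i := by rw [Fin.val_rev]; omega
    have hsub : (S.submatrix (Fin.last N).succAbove i.rev.succAbove).det =
        C (Matrix.det (Matrix.of fun (a c : Fin N) =>
          derivative^[(i.rev.succAbove c : Fin (N + 1))] (f a))) := by
      refine Eq.trans ?_ (RingHom.map_det (C : A[X] →+* A[X][X]) _).symm
      congr 1
      ext1 a c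
      simp [hS]
    have hsign := neg_one_pow_aux A[X][X] hi
    simp only [Fin.revPerm_apply, hsub, polyG, map_mul, map_pow, map_neg, map_one, Fin.val_last,
      hr, hsign]
    have hlast : S (Fin.last N) i.rev = X ^ (N - (i : ℕ)) := by
      simp [hS]
    rw [hlast]
    ring
  rw [h1, h2, map_sum]
  exact Finset.sum_congr rfl fun i _ => symOp_C_mul_X_pow _ _

/-- The elements `G_ijs` given by `G_i(u) = ∑_j G_ijs (u - b_s)^j`, with `G_ijs = 0` for `j < 0`.
Since `G_i` has degree at most `n - i` (and is zero if `n < i`), `G_ijs = 0` also for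
`j > n - i`. -/
def coeffG {N k : ℕ} (lam : Fin N → ℕ) (b : Fin k → ℂ) (s : Fin k) (i : Fin (N + 1)) (j : ℤ) :
    Olam lam :=
  if 0 ≤ j then (taylor (MvPolynomial.C (b s)) (polyG (genF lam) i)).coeff j.toNat else 0

/-- The number `n_s = |λ^(s)|`. -/
def size {N : ℕ} (mu : Fin N → ℕ) : ℕ := ∑ i, mu i

/-- The indicial polynomial `χ_s(α) = ∑_i G_{i,n_s-i,s} ∏_{j=0}^{N-i-1} (α - j)` at `b_s`. -/
def indicial {N k : ℕ} (lam : Fin N → ℕ) (Lam : Fin k → Fin N → ℕ) (b : Fin k → ℂ)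
    (s : Fin k) : (Olam lam)[X] :=
  ∑ i : Fin (N + 1), C (coeffG lam b s i ((size (Lam s) : ℤ) - (i : ℕ))) *
    ∏ j ∈ Finset.range (N - (i : ℕ)), (X - C (j : Olam lam))

/-- The leading coefficient `∏_{i<j} (d_j - d_i)` of the Wronskian of `f_1, …, f_N`. -/
def wrLead {N : ℕ} (lam : Fin N → ℕ) : ℂ :=
  ∏ i : Fin N, ∏ j ∈ Finset.Ioi i, ((expo lam j : ℂ) - (expo lam i : ℂ))

/-- The value prescribed for the indicial polynomial at `b_s`:
`∏_{i<j} (d_j - d_i) ∏_{r ≠ s} (b_s - b_r)^{n_r} ∏_l (α - λ^(s)_l - N + l)`. -/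
def indicialTarget {N k : ℕ} (lam : Fin N → ℕ) (Lam : Fin k → Fin N → ℕ) (b : Fin k → ℂ)
    (s : Fin k) : (Olam lam)[X] :=
  C (MvPolynomial.C (wrLead lam * ∏ r ∈ Finset.univ.erase s, (b s - b r) ^ size (Lam r))) *
    ∏ l : Fin N, (X - C (expo (Lam s) l : Olam lam))

/-- The ideal `I` of `O_λ` generated by the `G_ijs` with `0 ≤ j ≤ n_s - i - 1` and the
coefficients of the differences of the indicial polynomials and their prescribed values. -/
def idealI {N k : ℕ} (lam : Fin N → ℕ) (Lam : Fin k → Fin N → ℕ) (b : Fin k → ℂ) :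
    Ideal (Olam lam) :=
  Ideal.span
    ({y | ∃ (s : Fin k) (i : Fin (N + 1)) (j : ℤ), 0 ≤ j ∧
        j ≤ (size (Lam s) : ℤ) - (i : ℕ) - 1 ∧ y = coeffG lam b s i j} ∪
      {y | ∃ (s : Fin k) (m : ℕ),
        y = (indicial lam Lam b s - indicialTarget lam Lam b s).coeff m})

end SchubertIntersection

end

open SchubertIntersection

-- Both algebras represent the same functor. Fix a ℂ-algebra `A` and a specialization `φ` of the
-- coordinates in `A`. The claim is that `φ` kills `I` exactly when `SatisfiesCells φ` holds: at
-- each `b_s` the matrix `M_s` becomes invertible and its inverse turns the `f_i` into polynomials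
-- divisible by the prescribed powers of `u - b_s`.
--
-- From `I` to the cells, the argument is Frobenius' method. The generators of `I` make `b_s` a
-- regular singular point of the operator, with exponents `e_l` and an indicial polynomial whose
-- leading coefficient is a unit. A solution is then determined by its coefficients at the exponents
-- (`coeff_eq_zero_of_coeff_exponents_eq_zero`). This gives the divisibility, and modulo each
-- maximal ideal it shows that a degenerate `M_s` would make the `f_i` linearly dependent, which
-- their distinct degrees forbid (`isUnit_det_expoMatrix`).
--
-- From the cells to `I`, a basis with orders `e_l` and leading coefficients 1 gives minors whose
-- lowest coefficients are determinants of falling factorials. By a Vandermonde identity these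
-- assemble into a constant times `∏ (α - e_l)` (`X_pow_dvd_polyG_and_localIndicial`). The constant
-- is global: the Wronskian has degree at most `n = ∑ n_s` and vanishes to order `n_s` at each
-- `b_s`, so it is its known top coefficient times `∏ (u - b_s)^{n_s}`
-- (`coeff_taylor_of_X_pow_dvd_taylor`).
--
-- For maps out of `Q`, killing `J` is the same cell condition (`idealJ_le_ker_iff`). If `Ω` is
-- nonempty, `Q` is the localization of `O_λ` at the polynomials without zeros on `Ω`
-- (`isLocalization_QLam`). By the Nullstellensatz these are already invertible modulo `I`, because
-- the zeros of `I` lie on `Ω`; so the two quotients coincide. If `Ω` is empty, the same argument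
-- gives `I = O_λ`.

universe u

namespace SchubertIntersection

/-! ### Vandermonde identities for falling factorials -/

section Determinants

variable {R : Type*} [CommRing R] {N : ℕ}

/-- Expansion of a determinant along its last row, with the columns in reverse order. -/
theorem det_lastCases (w : Fin N → Fin (N + 1) → R) (v : Fin (N + 1) → R) :
    (Matrix.of fun (r c : Fin (N + 1)) =>
      Fin.lastCases (motive := fun _ => R) (v c) (fun a => w a c) r).det =
    ∑ i : Fin (N + 1), (-1) ^ (i : ℕ) *
      (Matrix.of fun (a c : Fin N) => w a (i.rev.succAbove c)).det * v i.rev := by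
  rw [Matrix.det_succ_row _ (Fin.last N), ← Equiv.sum_comp Fin.revPerm]
  refine Finset.sum_congr rfl fun i _ => ?_
  have hr : ((i.rev : Fin (N + 1)) : ℕ) = N - i := by rw [Fin.val_rev]; omega
  have hi : (i : ℕ) ≤ N := by omega
  have hsub : (Matrix.of fun (r c : Fin (N + 1)) =>
      Fin.lastCases (motive := fun _ => R) (v c) (fun a => w a c) r).submatrix
        (Fin.last N).succAbove i.rev.succAbove =
      Matrix.of fun (a c : Fin N) => w a (i.rev.succAbove c) := by
    ext a c
    simp
  simp only [Fin.revPerm_apply, hsub, Fin.val_last, hr, neg_one_pow_aux R hi]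
  simp only [Matrix.of_apply, Fin.lastCases_last]
  ring

/-- Omitting the column of order `N - i` from `0, …, N` leaves total order `i` above the
Wronskian's; hence the weight `X ^ i` that accompanies `polyG f i` below. -/
theorem sum_rev_succAbove (i : Fin (N + 1)) :
    ∑ c : Fin N, ((i.rev.succAbove c : Fin (N + 1)) : ℕ) = ∑ c : Fin N, (c : ℕ) + i := by
  have h1 := Fin.sum_univ_succAbove (fun c : Fin (N + 1) => (c : ℕ)) i.rev
  have h2 := Fin.sum_univ_castSucc (fun c : Fin (N + 1) => (c : ℕ))
  simp only [Fin.val_castSucc, Fin.val_last] at h2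
  have hr : ((i.rev : Fin (N + 1)) : ℕ) = N - i := by rw [Fin.val_rev]; omega
  omega

theorem prod_Ioi_castSucc (a : Fin N) (g : Fin (N + 1) → R) :
    ∏ j ∈ Finset.Ioi a.castSucc, g j = (∏ j ∈ Finset.Ioi a, g j.castSucc) * g (Fin.last N) := by
  have h : ∀ {m : ℕ} (a : Fin m), Finset.Ioi a = Finset.univ.filter (a < ·) := by
    intro m a; ext; simp
  simp only [h, Finset.prod_filter, Fin.prod_univ_castSucc, Fin.castSucc_lt_castSucc_iff,
    Fin.castSucc_lt_last, if_true]

/-- Falling factorials are monic of degree `c`, so they differ from the powers by a unitriangular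
column change. -/
theorem det_prod_sub_eq_vandermonde_of_isDomain [IsDomain R] (v : Fin N → R) :
    (Matrix.of fun (a c : Fin N) => ∏ j ∈ Finset.range (c : ℕ), (v a - (j : R))).det =
      ∏ a, ∏ j ∈ Finset.Ioi a, (v j - v a) := by
  rw [← Matrix.det_vandermonde,
    Matrix.det_eval_matrixOfPolynomials_eq_det_vandermonde v
      (fun i => descPochhammer R i) (fun i => descPochhammer_natDegree R i)
      (fun i => monic_descPochhammer R i)]
  simp only [descPochhammer_eval_eq_prod_range]

theorem cast_descFactorial_eq_prod (e c : ℕ) :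
    ((e.descFactorial c : ℕ) : R) = ∏ j ∈ Finset.range c, ((e : R) - (j : R)) := by
  rw [← descPochhammer_eval_eq_descFactorial, descPochhammer_eval_eq_prod_range]

theorem det_descFactorial (e : Fin N → ℕ) :
    (Matrix.of fun (a c : Fin N) => (((e a).descFactorial c : ℕ) : R)).det =
      ∏ a, ∏ j ∈ Finset.Ioi a, ((e j : R) - (e a : R)) := by
  have h := det_prod_sub_eq_vandermonde_of_isDomain (fun a => (e a : ℤ))
  simp only [← cast_descFactorial_eq_prod] at h
  have h' := congrArg (Int.castRingHom R) h
  rw [RingHom.map_det] at h'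
  simp only [map_prod, map_sub, eq_intCast, Int.cast_natCast] at h'
  rw [← h']
  congr 1
  ext a c
  simp

/-- The minors of the matrix of falling factorials of `e_1, …, e_N` are the coefficients, in the
basis of falling factorials, of the polynomial with roots `e_1, …, e_N`. -/
theorem sum_minor_descFactorial (e : Fin N → ℕ) :
    ∑ i : Fin (N + 1), C ((-1) ^ (i : ℕ) *
        (Matrix.of fun (a c : Fin N) =>
          (((e a).descFactorial (i.rev.succAbove c : Fin (N + 1)) : ℕ) : R)).det) *
        ∏ j ∈ Finset.range (N - (i : ℕ)), (X - C (j : R)) =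
      C (∏ a, ∏ j ∈ Finset.Ioi a, ((e j : R) - (e a : R))) * ∏ l, (X - C (e l : R)) := by
  -- The identity is universal, so it is proved over the domain `ℤ[X]` and then carried to `R[X]`.
  have key : ∑ i : Fin (N + 1), C ((-1) ^ (i : ℕ) *
        (Matrix.of fun (a c : Fin N) =>
          (((e a).descFactorial (i.rev.succAbove c : Fin (N + 1)) : ℕ) : ℤ)).det) *
        ∏ j ∈ Finset.range (N - (i : ℕ)), (X - C (j : ℤ)) =
      C (∏ a, ∏ j ∈ Finset.Ioi a, ((e j : ℤ) - (e a : ℤ))) * ∏ l, (X - C (e l : ℤ)) := by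
    -- The variable `X` is added as a last node after `e_1, …, e_N`. The Vandermonde product then
    -- contains all factors `X - e_l`, and expansion along the row of `X` produces the minors.
    have h := det_prod_sub_eq_vandermonde_of_isDomain (R := ℤ[X])
      (Fin.lastCases (motive := fun _ => ℤ[X]) X (fun a => C (e a : ℤ)))
    have h2 := det_lastCases (fun (a : Fin N) (c : Fin (N + 1)) =>
      (C ((((e a).descFactorial c : ℕ) : ℤ)) : ℤ[X]))
      (fun c => ∏ j ∈ Finset.range (c : ℕ), (X - C (j : ℤ)))
    have h3 : (Matrix.of fun (r c : Fin (N + 1)) =>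
        Fin.lastCases (motive := fun _ => ℤ[X]) (∏ j ∈ Finset.range (c : ℕ), (X - C (j : ℤ)))
          (fun a => (C ((((e a).descFactorial c : ℕ) : ℤ)) : ℤ[X])) r) =
        (Matrix.of fun (a c : Fin (N + 1)) => ∏ j ∈ Finset.range (c : ℕ),
          ((Fin.lastCases (motive := fun _ => ℤ[X]) X (fun a => C (e a : ℤ)) a : ℤ[X])
            - (j : ℤ[X]))) := by
      ext1 r c
      induction r using Fin.lastCases with
      | last => simp
      | cast r =>
        simp only [Matrix.of_apply, Fin.lastCases_castSucc]
        rw [cast_descFactorial_eq_prod]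
        simp
    rw [h3, h] at h2
    have h4 : ∀ i : Fin (N + 1), (Matrix.of fun (a c : Fin N) =>
        (C ((((e a).descFactorial (i.rev.succAbove c : Fin (N + 1)) : ℕ) : ℤ)) : ℤ[X])).det =
        C (Matrix.of fun (a c : Fin N) =>
          (((e a).descFactorial (i.rev.succAbove c : Fin (N + 1)) : ℕ) : ℤ)).det := by
      intro i
      rw [RingHom.map_det]
      rfl
    have hr : ∀ i : Fin (N + 1), ((i.rev : Fin (N + 1)) : ℕ) = N - i := by
      intro i; rw [Fin.val_rev]; omega
    simp only [h4, hr] at h2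
    have h5 : (∏ a : Fin (N + 1), ∏ j ∈ Finset.Ioi a,
        ((Fin.lastCases (motive := fun _ => ℤ[X]) X (fun a => C (e a : ℤ)) j : ℤ[X]) -
          Fin.lastCases (motive := fun _ => ℤ[X]) X (fun a => C (e a : ℤ)) a)) =
        C (∏ a, ∏ j ∈ Finset.Ioi a, ((e j : ℤ) - (e a : ℤ))) * ∏ l, (X - C (e l : ℤ)) := by
      rw [Fin.prod_univ_castSucc, map_prod, ← Finset.prod_mul_distrib]
      have : Finset.Ioi (Fin.last N) = ∅ := by ext x; simp [Fin.le_last]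
      rw [this, Finset.prod_empty, mul_one]
      refine Finset.prod_congr rfl fun a _ => ?_
      rw [prod_Ioi_castSucc]
      simp
    rw [← h5, h2]
    refine Finset.sum_congr rfl fun i _ => ?_
    simp
  have h := congrArg (mapRingHom (Int.castRingHom R)) key
  have hdet : ∀ i : Fin (N + 1), (Int.castRingHom R) (Matrix.of fun (a c : Fin N) =>
      (((e a).descFactorial (i.rev.succAbove c : Fin (N + 1)) : ℕ) : ℤ)).det =
      (Matrix.of fun (a c : Fin N) =>
        (((e a).descFactorial (i.rev.succAbove c : Fin (N + 1)) : ℕ) : R)).det := by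
    intro i
    rw [RingHom.map_det]
    congr 1
    ext a c
    simp
  simpa only [map_sum, map_mul, map_prod, map_sub, map_pow, map_neg, map_one, coe_mapRingHom,
    map_X, map_C, hdet, map_natCast] using h

end Determinants

/-! ### Extreme coefficients of determinants of polynomials -/

section PolynomialMatrices

variable {A : Type*} [CommRing A] {N : ℕ}

theorem natDegree_prod_le_and_coeff {ι : Type*} (s : Finset ι) (p : ι → A[X]) (d : ι → ℕ)
    (h : ∀ a ∈ s, (p a).natDegree ≤ d a) :
    (∏ a ∈ s, p a).natDegree ≤ ∑ a ∈ s, d a ∧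
      (∏ a ∈ s, p a).coeff (∑ a ∈ s, d a) = ∏ a ∈ s, (p a).coeff (d a) := by
  classical
  induction s using Finset.induction_on with
  | empty => simp
  | insert a s ha ih =>
    obtain ⟨h1, h2⟩ := ih fun b hb => h b (Finset.mem_insert_of_mem hb)
    have h3 := h a (Finset.mem_insert_self _ _)
    simp only [Finset.prod_insert ha, Finset.sum_insert ha]
    exact ⟨natDegree_mul_le_of_le h3 h1, by rw [coeff_mul_add_eq_of_natDegree_le h3 h1, h2]⟩

/-- The top coefficient of a determinant whose rows have bounded degrees. -/
theorem natDegree_det_le_and_coeff (M : Matrix (Fin N) (Fin N) A[X]) (d : Fin N → ℕ)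
    (h : ∀ a c, (M a c).natDegree ≤ d a) :
    M.det.natDegree ≤ ∑ a, d a ∧
      M.det.coeff (∑ a, d a) = (Matrix.of fun a c => (M a c).coeff (d a)).det := by
  rw [← Matrix.det_transpose, Matrix.det_apply', ← Matrix.det_transpose, Matrix.det_apply']
  constructor
  · refine natDegree_sum_le_of_forall_le _ _ fun σ _ => ?_
    refine (natDegree_mul_le_of_le (m := 0) ?_
      (natDegree_prod_le_and_coeff _ _ d fun a _ => h a (σ a)).1).trans (by simp)
    simp
  · rw [finsetSum_coeff]
    refine Finset.sum_congr rfl fun σ _ => ?_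
    rw [← Polynomial.C_eq_intCast, coeff_C_mul]
    exact congrArg _ (natDegree_prod_le_and_coeff _ _ d fun a _ => h a (σ a)).2

/-- The lowest coefficient of a determinant whose rows are divisible by powers of `X`. -/
theorem X_pow_dvd_det_and_coeff (M : Matrix (Fin N) (Fin N) A[X]) (e : Fin N → ℕ)
    (h : ∀ a c, X ^ e a ∣ M a c) :
    X ^ (∑ a, e a) ∣ M.det ∧
      M.det.coeff (∑ a, e a) = (Matrix.of fun a c => (M a c).coeff (e a)).det := by
  choose K hK using h
  have h1 : M = Matrix.of fun a c => X ^ e a * Matrix.of K a c := by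
    ext1 a c; exact hK a c
  have h2 : M.det = X ^ (∑ a, e a) * (Matrix.of K).det := by
    rw [h1, Matrix.det_mul_column, Finset.prod_pow_eq_pow_sum]
  refine ⟨⟨_, h2⟩, ?_⟩
  have h3 := coeff_X_pow_mul (Matrix.of K).det (∑ a, e a) 0
  rw [zero_add] at h3
  rw [h2, h3, ← constantCoeff_apply, RingHom.map_det]
  congr 1
  ext a c
  have h4 := coeff_X_pow_mul (K a c) (e a) 0
  rw [zero_add] at h4
  simp [hK, h4]

/-- The operator `X^c ∂^c` is diagonal on monomials, so it neither lowers orders nor raises degrees,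
and its eigenvalues are the falling factorials. -/
theorem coeff_X_pow_mul_iterate_derivative (p : A[X]) (c j : ℕ) :
    (X ^ c * derivative^[c] p).coeff j = (j.descFactorial c : A) * p.coeff j := by
  rw [coeff_X_pow_mul']
  split_ifs with h
  · rw [coeff_iterate_derivative, Nat.sub_add_cancel h, nsmul_eq_mul]
  · rw [Nat.descFactorial_of_lt (by omega)]
    simp

theorem X_pow_dvd_X_pow_mul_iterate_derivative {p : A[X]} {e : ℕ} (h : X ^ e ∣ p) (c : ℕ) :
    X ^ e ∣ X ^ c * derivative^[c] p := by
  rw [X_pow_dvd_iff] at h ⊢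
  intro j hj
  rw [coeff_X_pow_mul_iterate_derivative, h j hj, mul_zero]

theorem natDegree_X_pow_mul_iterate_derivative_le (p : A[X]) (c : ℕ) :
    (X ^ c * derivative^[c] p).natDegree ≤ p.natDegree := by
  rw [natDegree_le_iff_coeff_eq_zero]
  intro j hj
  rw [coeff_X_pow_mul_iterate_derivative, coeff_eq_zero_of_natDegree_lt hj, mul_zero]

end PolynomialMatrices

/-! ### Coefficients of the differential operator -/

section PolyG

variable {A : Type*} [CommRing A] {N : ℕ}

theorem polyG_map {B : Type*} [CommRing B] (φ : A →+* B) (f : Fin N → A[X]) (i : Fin (N + 1)) :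
    polyG (fun a => (f a).map φ) i = (polyG f i).map φ := by
  simp only [polyG, Polynomial.map_mul, Polynomial.map_pow, Polynomial.map_neg,
    Polynomial.map_one]
  congr 1
  rw [← coe_mapRingHom, RingHom.map_det]
  congr 1
  ext1 a c
  simp [iterate_derivative_map]

theorem iterate_derivative_taylor (r : A) (p : A[X]) (n : ℕ) :
    derivative^[n] (taylor r p) = taylor r (derivative^[n] p) := by
  induction n generalizing p with
  | zero => rfl
  | succ n ih =>
    rw [Function.iterate_succ_apply, Function.iterate_succ_apply, ← ih]
    congr 1
    rw [taylor_apply, taylor_apply, derivative_comp]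
    simp

theorem polyG_taylor (r : A) (f : Fin N → A[X]) (i : Fin (N + 1)) :
    polyG (fun a => taylor r (f a)) i = taylor r (polyG f i) := by
  have h : ∀ p : A[X], taylor r p = (taylorAlgHom r : A[X] →+* A[X]) p := fun _ => rfl
  simp only [polyG]
  rw [h ((-1) ^ (i : ℕ) * _), map_mul, map_pow, map_neg, map_one, RingHom.map_det]
  congr 2
  ext1 a c
  exact iterate_derivative_taylor _ _ _

/-- A linear change of the rows multiplies the operator by the determinant of the change. -/
theorem polyG_sum_C_mul (M : Matrix (Fin N) (Fin N) A) (f : Fin N → A[X]) (i : Fin (N + 1)) :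
    polyG (fun a => ∑ m, C (M a m) * f m) i = C M.det * polyG f i := by
  have h : (Matrix.of fun (a c : Fin N) =>
      derivative^[(i.rev.succAbove c : Fin (N + 1))] (∑ m, C (M a m) * f m)) =
      M.map C * Matrix.of fun (a c : Fin N) =>
        derivative^[(i.rev.succAbove c : Fin (N + 1))] (f a) := by
    ext1 a c
    simp [Matrix.mul_apply, iterate_derivative_sum, iterate_derivative_C_mul]
  rw [polyG, h, Matrix.det_mul, polyG, RingHom.map_det]
  simp only [RingHom.mapMatrix_apply]
  ring

/-- The operator with coefficients `polyG f i` annihilates each of the polynomials `f a`. -/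
theorem sum_polyG_mul_iterate_derivative (f : Fin N → A[X]) (a : Fin N) :
    ∑ i : Fin (N + 1), polyG f i * derivative^[N - (i : ℕ)] (f a) = 0 := by
  have h := det_lastCases (fun (a : Fin N) (c : Fin (N + 1)) => derivative^[c] (f a))
    (fun c => derivative^[c] (f a))
  have hr : ∀ i : Fin (N + 1), ((i.rev : Fin (N + 1)) : ℕ) = N - i := by
    intro i; rw [Fin.val_rev]; omega
  simp only [hr] at h
  refine h.symm.trans (Matrix.det_zero_of_row_eq (Fin.castSucc_lt_last a).ne ?_)
  ext1 c
  simp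

/-- Spreading the power of `X` over the columns replaces each `∂^c` by the diagonal operator `X^c
∂^c`, after which orders and degrees can be read off row by row. -/
theorem X_pow_mul_X_pow_mul_polyG (f : Fin N → A[X]) (i : Fin (N + 1)) :
    X ^ (∑ c : Fin N, (c : ℕ)) * (X ^ (i : ℕ) * polyG f i) =
      C ((-1) ^ (i : ℕ)) * (Matrix.of fun (a c : Fin N) =>
        X ^ ((i.rev.succAbove c : Fin (N + 1)) : ℕ) *
          derivative^[(i.rev.succAbove c : Fin (N + 1))] (f a)).det := by
  rw [← mul_assoc, ← pow_add, ← sum_rev_succAbove]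
  have h := Matrix.det_mul_row
    (fun c : Fin N => (X : A[X]) ^ ((i.rev.succAbove c : Fin (N + 1)) : ℕ))
    (Matrix.of fun (a c : Fin N) => derivative^[(i.rev.succAbove c : Fin (N + 1))] (f a))
  rw [Finset.prod_pow_eq_pow_sum] at h
  simp only [Matrix.of_apply] at h
  rw [h, polyG]
  simp only [map_pow, map_neg, map_one]
  ring

/-- The lowest coefficients of the operator annihilating polynomials `f a` of prescribed
orders at `0`. -/
theorem X_pow_dvd_polyG_and_coeff (f : Fin N → A[X]) (e : Fin N → ℕ)
    (hf : ∀ a, X ^ e a ∣ f a) (n : ℕ) (hn : n + ∑ c : Fin N, (c : ℕ) = ∑ a, e a)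
    (i : Fin (N + 1)) :
    X ^ n ∣ X ^ (i : ℕ) * polyG f i ∧ (X ^ (i : ℕ) * polyG f i).coeff n =
      (-1) ^ (i : ℕ) * (Matrix.of fun (a c : Fin N) =>
        ((e a).descFactorial (i.rev.succAbove c : Fin (N + 1)) : A) * (f a).coeff (e a)).det := by
  obtain ⟨h1, h2⟩ := X_pow_dvd_det_and_coeff (Matrix.of fun (a c : Fin N) =>
    X ^ ((i.rev.succAbove c : Fin (N + 1)) : ℕ) *
      derivative^[(i.rev.succAbove c : Fin (N + 1))] (f a)) e
    fun a c => X_pow_dvd_X_pow_mul_iterate_derivative (hf a) _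
  have h3 := X_pow_mul_X_pow_mul_polyG f i
  simp only [Matrix.of_apply, coeff_X_pow_mul_iterate_derivative] at h2
  constructor
  · rw [X_pow_dvd_iff] at h1 ⊢
    intro j hj
    rw [← coeff_X_pow_mul _ (∑ c : Fin N, (c : ℕ)) j, h3, coeff_C_mul, h1 _ (by omega), mul_zero]
  · rw [← coeff_X_pow_mul _ (∑ c : Fin N, (c : ℕ)) n, h3, coeff_C_mul, hn, h2]

/-- The degree and the leading coefficient of the Wronskian. -/
theorem natDegree_polyG_zero_le_and_coeff (f : Fin N → A[X]) (d : Fin N → ℕ)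
    (hf : ∀ a, (f a).natDegree ≤ d a) (hd : ∀ a, (f a).coeff (d a) = 1) (n : ℕ)
    (hn : n + ∑ c : Fin N, (c : ℕ) = ∑ a, d a) :
    (polyG f 0).natDegree ≤ n ∧
      (polyG f 0).coeff n = ∏ a, ∏ j ∈ Finset.Ioi a, ((d j : A) - (d a : A)) := by
  obtain ⟨h1, h2⟩ := natDegree_det_le_and_coeff (Matrix.of fun (a c : Fin N) =>
    X ^ (((0 : Fin (N + 1)).rev.succAbove c : Fin (N + 1)) : ℕ) *
      derivative^[((0 : Fin (N + 1)).rev.succAbove c : Fin (N + 1))] (f a)) d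
    fun a c => by
      rw [Matrix.of_apply]
      exact (natDegree_X_pow_mul_iterate_derivative_le _ _).trans (hf a)
  have h3 := X_pow_mul_X_pow_mul_polyG f 0
  simp only [Fin.val_zero, pow_zero, one_mul, C_1] at h3
  rw [← h3] at h1 h2
  simp only [Matrix.of_apply, coeff_X_pow_mul_iterate_derivative, hd, mul_one, Fin.rev_zero,
    Fin.succAbove_last, Fin.val_castSucc] at h2
  constructor
  · rw [natDegree_le_iff_coeff_eq_zero] at h1 ⊢
    intro j hj
    rw [← coeff_X_pow_mul _ (∑ c : Fin N, (c : ℕ)) j, h1 _ (by omega)]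
  · rw [← coeff_X_pow_mul _ (∑ c : Fin N, (c : ℕ)) n, hn, h2, det_descFactorial]

end PolyG

/-! ### Frobenius' method at a regular singular point -/

section LocalTheory

variable {A : Type*} [CommRing A] {N : ℕ}

/-- Among the surviving terms with `d a ≥ m`, the one of largest degree alone contributes to its top
coefficient. The cutoff `m` serves the dimension count for the flag at infinity; `m = 0` is linear
independence. -/
theorem eq_zero_of_coeff_sum_C_mul_eq_zero (f : Fin N → A[X]) (d : Fin N → ℕ)
    (hd : Function.Injective d) (hf : ∀ a, (f a).natDegree ≤ d a)
    (hf1 : ∀ a, (f a).coeff (d a) = 1) (v : Fin N → A) (m : ℕ)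
    (h : ∀ j, m ≤ j → (∑ a, C (v a) * f a).coeff j = 0) (a : Fin N) (ha : m ≤ d a) : v a = 0 := by
  classical
  by_contra hv
  obtain ⟨a, ha, hmax⟩ := Finset.exists_max_image
    (Finset.univ.filter fun a => v a ≠ 0 ∧ m ≤ d a) d ⟨a, by simpa using ⟨hv, ha⟩⟩
  obtain ⟨hva, hma⟩ := (Finset.mem_filter.mp ha).2
  have h1 := h (d a) hma
  simp only [finsetSum_coeff, coeff_C_mul] at h1
  rw [Finset.sum_eq_single a, hf1, mul_one] at h1
  · exact hva h1
  · intro c _ hca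
    by_cases hc : v c = 0
    · rw [hc, zero_mul]
    · have h2 : d c < d a := by
        by_cases hmc : m ≤ d c
        · exact lt_of_le_of_ne (hmax c (by simpa using ⟨hc, hmc⟩)) fun h => hca (hd h)
        · omega
      rw [coeff_eq_zero_of_natDegree_lt ((hf c).trans_lt h2), mul_zero]
  · simp

/-- Monic polynomials of distinct degrees are linearly independent. -/
theorem eq_zero_of_sum_C_mul_eq_zero (f : Fin N → A[X]) (d : Fin N → ℕ)
    (hd : Function.Injective d) (hf : ∀ a, (f a).natDegree ≤ d a)
    (hf1 : ∀ a, (f a).coeff (d a) = 1) (v : Fin N → A) (h : ∑ a, C (v a) * f a = 0) : v = 0 :=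
  funext fun a => eq_zero_of_coeff_sum_C_mul_eq_zero f d hd hf hf1 v 0
    (fun j _ => by rw [h, coeff_zero]) a (Nat.zero_le _)

theorem sum_polyG_mul_iterate_derivative_sum (F : Fin N → A[X]) (v : Fin N → A) :
    ∑ i : Fin (N + 1), polyG F i * derivative^[N - (i : ℕ)] (∑ a, C (v a) * F a) = 0 := by
  simp only [iterate_derivative_sum, iterate_derivative_C_mul, Finset.mul_sum]
  rw [Finset.sum_comm]
  refine Finset.sum_eq_zero fun a _ => ?_
  calc ∑ i : Fin (N + 1), polyG F i * (C (v a) * derivative^[N - (i : ℕ)] (F a))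
      = C (v a) * ∑ i : Fin (N + 1), polyG F i * derivative^[N - (i : ℕ)] (F a) := by
        rw [Finset.mul_sum]
        exact Finset.sum_congr rfl fun i _ => by ring
    _ = 0 := by rw [sum_polyG_mul_iterate_derivative, mul_zero]

/-- The indicial polynomial at `0` of the operator attached to `F`. -/
noncomputable def localIndicial (F : Fin N → A[X]) (n : ℕ) : A[X] :=
  ∑ i : Fin (N + 1), C ((X ^ (i : ℕ) * polyG F i).coeff n) *
    ∏ j ∈ Finset.range (N - (i : ℕ)), (X - C (j : A))

/-- If `0` is a regular singular point of the operator, the first nonzero coefficient of a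
solution is killed by the value of the indicial polynomial. -/
theorem eval_localIndicial_mul_coeff (F : Fin N → A[X]) (n : ℕ)
    (hdiv : ∀ i : Fin (N + 1), X ^ n ∣ X ^ (i : ℕ) * polyG F i) (v : Fin N → A) (j : ℕ)
    (hlow : ∀ k < j, (∑ a, C (v a) * F a).coeff k = 0) :
    (localIndicial F n).eval (j : A) * (∑ a, C (v a) * F a).coeff j = 0 := by
  set p := ∑ a, C (v a) * F a with hp
  choose R hR using hdiv
  have h0 := sum_polyG_mul_iterate_derivative_sum F v
  rw [← hp] at h0
  -- Multiplying the equation by `X^N` brings it to the Fuchsian form `∑ R_i X^{N-i} ∂^{N-i}`, with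
  -- the common factor `X^n` split off.
  have h1 : X ^ n * ∑ i : Fin (N + 1), R i * (X ^ (N - (i : ℕ)) *
      derivative^[N - (i : ℕ)] p) = 0 := by
    rw [Finset.mul_sum]
    calc _ = ∑ i : Fin (N + 1), X ^ N * (polyG F i * derivative^[N - (i : ℕ)] p) := by
          refine Finset.sum_congr rfl fun i _ => ?_
          rw [← mul_assoc, ← hR]
          have : (X : A[X]) ^ N = X ^ (i : ℕ) * X ^ (N - (i : ℕ)) := by
            rw [← pow_add]; congr 1; omega
          rw [this]; ring
      _ = 0 := by rw [← Finset.mul_sum, h0, mul_zero]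
  have h2 := congrArg (fun q => q.coeff (j + n)) h1
  simp only [coeff_X_pow_mul, coeff_zero, finsetSum_coeff] at h2
  have h3 : ∀ i : Fin (N + 1), (R i * (X ^ (N - (i : ℕ)) * derivative^[N - (i : ℕ)] p)).coeff j =
      (R i).coeff 0 * ((j.descFactorial (N - (i : ℕ)) : A) * p.coeff j) := by
    intro i
    -- Coefficients of `p` below `j` vanish, so only the constant term of `R_i` meets the `j`-th
    -- coefficient.
    rw [coeff_mul, Finset.sum_eq_single (0, j)]
    · rw [coeff_X_pow_mul_iterate_derivative]
    · rintro ⟨x, y⟩ hxy hne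
      replace hxy : x + y = j := by simpa using hxy
      rw [coeff_X_pow_mul_iterate_derivative, hlow y, mul_zero, mul_zero]
      rcases Nat.eq_zero_or_pos x with hx | hx
      · exact absurd (by rw [Prod.mk.injEq]; omega) hne
      · omega
    · simp
  rw [← h2, localIndicial, eval_finsetSum, Finset.sum_mul]
  refine Finset.sum_congr rfl fun i _ => ?_
  have h4 := coeff_X_pow_mul (R i) n 0
  rw [zero_add] at h4
  rw [h3, hR, h4, cast_descFactorial_eq_prod]
  simp only [eval_mul, eval_C, eval_prod, eval_sub, eval_X]
  ring

/-- A solution is determined by its coefficients at the exponents. -/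
theorem coeff_eq_zero_of_coeff_exponents_eq_zero [Algebra ℂ A] (F : Fin N → A[X]) (n : ℕ)
    (e : Fin N → ℕ) (hdiv : ∀ i : Fin (N + 1), X ^ n ∣ X ^ (i : ℕ) * polyG F i) (c : A)
    (hc : IsUnit c) (hχ : localIndicial F n = C c * ∏ l, (X - C (e l : A))) (v : Fin N → A)
    (m : ℕ) (h : ∀ l, e l < m → (∑ a, C (v a) * F a).coeff (e l) = 0) (j : ℕ) (hj : j < m) :
    (∑ a, C (v a) * F a).coeff j = 0 := by
  induction j using Nat.strong_induction_on with
  | _ j ih =>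
    by_cases hl : ∃ l, e l = j
    · obtain ⟨l, rfl⟩ := hl
      exact h l hj
    · have h1 := eval_localIndicial_mul_coeff F n hdiv v j fun k hk => ih k hk (hk.trans hj)
      -- Away from the exponents, the value is a unit times nonzero integers, which are invertible
      -- in a ℂ-algebra.
      have hu : IsUnit ((localIndicial F n).eval (j : A)) := by
        rw [hχ, eval_mul, eval_C, eval_prod]
        refine hc.mul (IsUnit.prod_univ_iff.mpr fun l => ?_)
        have hne : ((j : ℂ) - (e l : ℂ)) ≠ 0 := by
          rw [sub_ne_zero]
          exact_mod_cast fun h : j = e l => hl ⟨l, h.symm⟩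
        have := (IsUnit.mk0 _ hne).map (algebraMap ℂ A)
        simpa using this
      exact hu.mul_right_eq_zero.mp h1

/-- The matrix of coefficients of the polynomials `F a` at the exponents. -/
noncomputable def expoMatrix (F : Fin N → A[X]) (e : Fin N → ℕ) : Matrix (Fin N) (Fin N) A :=
  Matrix.of fun a l => (F a).coeff (e l)

theorem coeff_sum_C_mul_eq_mul_expoMatrix (F : Fin N → A[X]) (e : Fin N → ℕ)
    (B : Matrix (Fin N) (Fin N) A) (i l : Fin N) :
    (∑ m, C (B i m) * F m).coeff (e l) = (B * expoMatrix F e) i l := by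
  simp [Matrix.mul_apply, expoMatrix, finsetSum_coeff]

theorem localIndicial_map {B : Type*} [CommRing B] (φ : A →+* B) (F : Fin N → A[X]) (n : ℕ) :
    localIndicial (fun a => (F a).map φ) n = (localIndicial F n).map φ := by
  have h : ∀ i : Fin (N + 1), (X ^ (i : ℕ) * polyG (fun a => (F a).map φ) i).coeff n =
      φ ((X ^ (i : ℕ) * polyG F i).coeff n) := by
    intro i
    rw [polyG_map, ← coeff_map]
    simp
  simp [localIndicial, h, Polynomial.map_sum, Polynomial.map_prod]

/-- If the operator has a regular singular point at `0` with exponents `e`, then its solutions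
`F a` have an invertible matrix of coefficients at the exponents, provided that the solutions
stay linearly independent over all residue fields. -/
theorem isUnit_det_expoMatrix [Algebra ℂ A] (f : Fin N → A[X]) (b : A) (d : Fin N → ℕ)
    (hd : Function.Injective d) (hf : ∀ a, (f a).natDegree ≤ d a)
    (hf1 : ∀ a, (f a).coeff (d a) = 1) (n : ℕ) (e : Fin N → ℕ)
    (hdiv : ∀ i : Fin (N + 1), X ^ n ∣ X ^ (i : ℕ) * polyG (fun a => taylor b (f a)) i) (c : A)
    (hc : IsUnit c)
    (hχ : localIndicial (fun a => taylor b (f a)) n = C c * ∏ l, (X - C (e l : A))) :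
    IsUnit (expoMatrix (fun a => taylor b (f a)) e).det := by
  by_contra hu
  -- Over the residue field a singular matrix has a kernel vector, that is, a solution vanishing at
  -- all exponents and hence identically.
  obtain ⟨m, hm, hmem⟩ := exists_max_ideal_of_mem_nonunits hu
  let _ : Field (A ⧸ m) := Ideal.Quotient.field m
  set φ : A →+* A ⧸ m := Ideal.Quotient.mk m with hφ
  set f' : Fin N → (A ⧸ m)[X] := fun a => (f a).map φ
  have hF : (fun a => taylor (φ b) (f' a)) = fun a => (taylor b (f a)).map φ := by
    funext a; rw [map_taylor]
  have hdiv' : ∀ i : Fin (N + 1), X ^ n ∣ X ^ (i : ℕ) * polyG (fun a => taylor (φ b) (f' a)) i := by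
    intro i
    rw [hF, polyG_map]
    simpa using Polynomial.map_dvd φ (hdiv i)
  have hχ' : localIndicial (fun a => taylor (φ b) (f' a)) n =
      C (φ c) * ∏ l, (X - C (e l : A ⧸ m)) := by
    rw [hF, localIndicial_map, hχ]
    simp [Polynomial.map_prod]
  have hdet : (expoMatrix (fun a => taylor (φ b) (f' a)) e).det = 0 := by
    have h1 : expoMatrix (fun a => taylor (φ b) (f' a)) e =
        φ.mapMatrix (expoMatrix (fun a => taylor b (f a)) e) := by
      rw [hF]; ext a l; simp [expoMatrix, -map_taylor]
    rw [h1, ← RingHom.map_det]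
    exact Ideal.Quotient.eq_zero_iff_mem.mpr hmem
  obtain ⟨v, hv, hv0⟩ := Matrix.exists_vecMul_eq_zero_iff.mpr hdet
  apply hv
  refine eq_zero_of_sum_C_mul_eq_zero f' d hd (fun a => natDegree_map_le.trans (hf a))
    (fun a => by simp [f', coeff_map, hf1]) v ?_
  apply taylor_injective (φ b)
  rw [map_zero]
  have h2 : taylor (φ b) (∑ a, C (v a) * f' a) = ∑ a, C (v a) * taylor (φ b) (f' a) := by
    simp [map_sum, taylor_mul]
  rw [h2]
  ext j
  rw [coeff_zero]
  refine coeff_eq_zero_of_coeff_exponents_eq_zero _ n e hdiv' _ (hc.map φ) hχ' v (j + 1)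
    (fun l _ => ?_) j (Nat.lt_succ_self j)
  have h3 := congrFun hv0 l
  simpa [Matrix.vecMul, dotProduct, expoMatrix, finsetSum_coeff] using h3

/-- The `i`-th combination has coefficient zero at every exponent other than `e i`, in particular at
those below it, and the recursion propagates this to all lower coefficients. -/
theorem X_pow_dvd_of_mul_expoMatrix_eq_one [Algebra ℂ A] (F : Fin N → A[X]) (n : ℕ)
    (e : Fin N → ℕ) (hdiv : ∀ i : Fin (N + 1), X ^ n ∣ X ^ (i : ℕ) * polyG F i) (c : A)
    (hc : IsUnit c) (hχ : localIndicial F n = C c * ∏ l, (X - C (e l : A)))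
    (B : Matrix (Fin N) (Fin N) A) (hB : B * expoMatrix F e = 1) (i : Fin N) :
    X ^ e i ∣ ∑ m, C (B i m) * F m := by
  rw [X_pow_dvd_iff]
  refine coeff_eq_zero_of_coeff_exponents_eq_zero F n e hdiv c hc hχ (B i) (e i) fun l hl => ?_
  rw [coeff_sum_C_mul_eq_mul_expoMatrix, hB, Matrix.one_apply_ne]
  rintro rfl
  exact lt_irrefl _ hl

/-- Polynomials with a basis of exponents `e` at `0` are solutions of an operator with a regular
singular point at `0` and indicial roots `e`. -/
theorem X_pow_dvd_polyG_and_localIndicial (F : Fin N → A[X]) (n : ℕ) (e : Fin N → ℕ)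
    (hn : n + ∑ c : Fin N, (c : ℕ) = ∑ a, e a) (B : Matrix (Fin N) (Fin N) A)
    (hB : B * expoMatrix F e = 1) (hg : ∀ i, X ^ e i ∣ ∑ m, C (B i m) * F m) :
    (∀ i : Fin (N + 1), X ^ n ∣ X ^ (i : ℕ) * polyG F i) ∧
      localIndicial F n = C ((polyG F 0).coeff n) * ∏ l, (X - C (e l : A)) := by
  set M := expoMatrix F e
  set g : Fin N → A[X] := fun i => ∑ m, C (B i m) * F m
  -- Passing to the normalized basis `g` only scales the operator by `det M`, so its lowest
  -- coefficients can be computed from `g`.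
  have hF : F = fun a => ∑ i, C (M a i) * g i := by
    funext a
    have h1 : ∑ i, C (M a i) * g i = ∑ m, C ((M * B) a m) * F m := by
      simp only [g, Finset.mul_sum, Matrix.mul_apply, map_sum, Finset.sum_mul]
      rw [Finset.sum_comm]
      simp only [map_mul, mul_assoc]
    rw [h1, mul_eq_one_comm.mp hB]
    simp [Matrix.one_apply]
  have hg1 : ∀ i, (g i).coeff (e i) = 1 := by
    intro i
    simp only [g]
    rw [coeff_sum_C_mul_eq_mul_expoMatrix, hB, Matrix.one_apply_eq]
  have key : ∀ i : Fin (N + 1), X ^ (i : ℕ) * polyG F i =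
      C M.det * (X ^ (i : ℕ) * polyG g i) := by
    intro i
    conv_lhs => rw [hF, polyG_sum_C_mul]
    ring
  have hloc := fun i => X_pow_dvd_polyG_and_coeff g e hg n hn i
  have hcoeff : ∀ i : Fin (N + 1), (X ^ (i : ℕ) * polyG F i).coeff n = M.det *
      ((-1) ^ (i : ℕ) * (Matrix.of fun (a c : Fin N) =>
        ((e a).descFactorial (i.rev.succAbove c : Fin (N + 1)) : A)).det) := by
    intro i
    rw [key, coeff_C_mul, (hloc i).2]
    simp only [hg1, mul_one]
  refine ⟨fun i => ?_, ?_⟩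
  · rw [key]
    exact (hloc i).1.mul_left _
  -- The case `i = 0` identifies `det M` times the Vandermonde product with the lowest Wronskian
  -- coefficient.
  · have h0 := hcoeff 0
    simp only [Fin.val_zero, pow_zero, one_mul, Fin.rev_zero, Fin.succAbove_last,
      Fin.val_castSucc, det_descFactorial] at h0
    rw [h0, map_mul, mul_assoc, ← sum_minor_descFactorial, localIndicial, Finset.mul_sum]
    refine Finset.sum_congr rfl fun i _ => ?_
    rw [hcoeff, map_mul, mul_assoc]

/-- A polynomial of degree at most `∑ n_s` that vanishes at distinct points `b_s` to the orders
`n_s` is a multiple of `∏ (u - b_s)^{n_s}`; its lowest coefficient at `b_s`. -/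
theorem coeff_taylor_of_X_pow_dvd_taylor [Algebra ℂ A] {k : ℕ} (b : Fin k → ℂ)
    (hb : Function.Injective b) (n : Fin k → ℕ) (W : A[X]) (hW : W.natDegree ≤ ∑ s, n s)
    (hdvd : ∀ s, X ^ n s ∣ taylor (algebraMap ℂ A (b s)) W) (s : Fin k) :
    (taylor (algebraMap ℂ A (b s)) W).coeff (n s) = W.coeff (∑ s, n s) *
      algebraMap ℂ A (∏ r ∈ Finset.univ.erase s, (b s - b r) ^ n r) := by
  nontriviality A
  set P : A[X] := ∏ r, (X - C (algebraMap ℂ A (b r))) ^ n r with hP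
  have hmon : P.Monic := monic_prod_of_monic _ _ fun r _ => (monic_X_sub_C _).pow _
  have hdeg : P.natDegree = ∑ s, n s := by
    rw [hP, natDegree_prod_of_monic _ _ fun r _ => (monic_X_sub_C _).pow _]
    simp [(monic_X_sub_C _).natDegree_pow]
  have h1 : P ∣ W := by
    -- Coprimality holds over the field ℂ and is transported to `A`, which need not be a domain.
    refine Finset.prod_dvd_of_coprime (fun r _ t _ hrt => ?_) fun r _ => ?_
    · have h := (pairwise_coprime_X_sub_C hb hrt).pow (m := n r) (n := n t)
      simpa using h.map (mapRingHom (algebraMap ℂ A))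
    · have h := map_dvd (taylorAlgHom (-algebraMap ℂ A (b r))) (hdvd r)
      have h' : ∀ (z : A) (p : A[X]), taylorAlgHom z p = taylor z p := fun _ _ => rfl
      rw [h', h', taylor_taylor] at h
      simpa [taylor_zero, sub_eq_add_neg] using h
  obtain ⟨q, hq⟩ := h1
  -- Since `P` is monic, degrees add even over `A`, and `P` already has the maximal degree allowed
  -- for `W`.
  have hq0 : q.natDegree = 0 := by
    by_cases hq' : q = 0
    · simp [hq']
    · rw [hq, hmon.natDegree_mul' hq', hdeg] at hW
      omega
  rw [eq_C_of_natDegree_eq_zero hq0] at hq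
  have h2 : W.coeff (∑ s, n s) = q.coeff 0 := by
    rw [hq, coeff_mul_C, ← hdeg, hmon.coeff_natDegree, one_mul]
  have h3 : ∀ z : A, taylor z P = ∏ r, (X + C (z - algebraMap ℂ A (b r))) ^ n r := by
    intro z
    have h' : taylor z P = taylorAlgHom z P := rfl
    rw [h', hP, map_prod]
    refine Finset.prod_congr rfl fun r _ => ?_
    rw [map_pow]
    congr 1
    change taylor z _ = _
    simp only [map_sub, taylor_X, taylor_C]
    ring
  rw [h2, hq, taylor_mul, taylor_C, coeff_mul_C, mul_comm]
  congr 1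
  rw [h3, ← Finset.mul_prod_erase _ _ (Finset.mem_univ s), sub_self, C_0, add_zero]
  have h4 := coeff_X_pow_mul (∏ r ∈ Finset.univ.erase s,
    (X + C (algebraMap ℂ A (b s) - algebraMap ℂ A (b r))) ^ n r) (n s) 0
  rw [zero_add] at h4
  rw [h4, coeff_zero_eq_eval_zero, eval_prod]
  simp

end LocalTheory

/-! ### The ideal `I` and the cell equations over an arbitrary algebra -/

section Global

variable {N k : ℕ} {lam : Fin N → ℕ}

theorem expo_injective {mu : Fin N → ℕ} (h : Antitone mu) : Function.Injective (expo mu) := by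
  intro i j hij
  unfold expo at hij
  rcases lt_trichotomy i j with h1 | h1 | h1
  · have := h h1.le; rw [Fin.lt_def] at h1; omega
  · exact h1
  · have := h h1.le; rw [Fin.lt_def] at h1; omega

theorem size_add_sum (mu : Fin N → ℕ) : size mu + ∑ c : Fin N, (c : ℕ) = ∑ i, expo mu i := by
  simp only [size, expo, Finset.sum_add_distrib, add_right_inj]
  rw [← Equiv.sum_comp Fin.revPerm]
  refine Finset.sum_congr rfl fun i _ => ?_
  rw [Fin.revPerm_apply, Fin.val_rev]
  omega

theorem coeff_genF_sub_X_pow (i : Fin N) (n : ℕ) (hn : expo lam i ≤ n) :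
    (genF lam i - X ^ expo lam i).coeff n = 0 := by
  have h : genF lam i - X ^ expo lam i = (∑ j ∈ Finset.Icc 1 (expo lam i),
      if h : 1 ≤ j ∧ j ≤ expo lam i ∧ ∀ l, expo lam l ≠ expo lam i - j then
        C (MvPolynomial.X (⟨(i, j), h⟩ : CoordIdx lam)) * X ^ (expo lam i - j)
      else 0 : (Olam lam)[X]) := sub_eq_of_eq_add' rfl
  rw [h, finsetSum_coeff]
  refine Finset.sum_eq_zero fun j hj => ?_
  rw [Finset.mem_Icc] at hj
  have hmon : ∀ a : Olam lam, (C a * X ^ (expo lam i - j)).coeff n = 0 := fun a => by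
    rw [coeff_C_mul, coeff_X_pow, if_neg (by omega), mul_zero]
  split_ifs
  · exact hmon _
  · exact coeff_zero n

theorem natDegree_genF_le (i : Fin N) : (genF lam i).natDegree ≤ expo lam i := by
  rw [natDegree_le_iff_coeff_eq_zero]
  intro n hn
  have h := coeff_genF_sub_X_pow (lam := lam) i n hn.le
  rwa [coeff_sub, coeff_X_pow, if_neg hn.ne', sub_zero] at h

theorem coeff_genF_expo (i : Fin N) : (genF lam i).coeff (expo lam i) = 1 := by
  have h := coeff_genF_sub_X_pow (lam := lam) i _ le_rfl
  rwa [coeff_sub, coeff_X_pow, if_pos rfl, sub_eq_zero] at h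

variable {A : Type*} [CommRing A] [Algebra ℂ A]

/-- The specializations of the polynomials `f_i(u)` expanded at the point `z`. -/
noncomputable def shiftedGenF (φ : Olam lam →ₐ[ℂ] A) (z : ℂ) (a : Fin N) : A[X] :=
  taylor (algebraMap ℂ A z) ((genF lam a).map (φ : Olam lam →+* A))

theorem algHom_C (φ : Olam lam →ₐ[ℂ] A) (z : ℂ) :
    (φ : Olam lam →+* A) (MvPolynomial.C z) = algebraMap ℂ A z :=
  φ.commutes z

theorem shiftedGenF_eq_map (φ : Olam lam →ₐ[ℂ] A) (z : ℂ) :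
    shiftedGenF φ z =
      fun a => (taylor (MvPolynomial.C z) (genF lam a)).map (φ : Olam lam →+* A) := by
  funext a
  rw [shiftedGenF, map_taylor, algHom_C]

theorem polyG_shiftedGenF (φ : Olam lam →ₐ[ℂ] A) (z : ℂ) (i : Fin (N + 1)) :
    polyG (shiftedGenF φ z) i =
      (taylor (MvPolynomial.C z) (polyG (genF lam) i)).map (φ : Olam lam →+* A) := by
  rw [shiftedGenF_eq_map, polyG_map, polyG_taylor]

/-- The factor `X ^ i` absorbs the index shift; a negative index corresponds to a coefficient below
the order of `X ^ i`, so both sides are then zero. -/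
theorem map_coeffG (φ : Olam lam →ₐ[ℂ] A) (b : Fin k → ℂ) (s : Fin k) (i : Fin (N + 1)) (n : ℕ) :
    φ (coeffG lam b s i ((n : ℤ) - (i : ℕ))) =
      (X ^ (i : ℕ) * polyG (shiftedGenF φ (b s)) i).coeff n := by
  rw [coeffG, coeff_X_pow_mul', polyG_shiftedGenF]
  by_cases h : (i : ℕ) ≤ n
  · rw [if_pos (by omega), if_pos h, coeff_map]
    rw [show ((n : ℤ) - (i : ℕ)).toNat = n - i by omega]
    rfl
  · rw [if_neg (by omega), if_neg h, map_zero]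

theorem map_indicial (φ : Olam lam →ₐ[ℂ] A) (Lam : Fin k → Fin N → ℕ) (b : Fin k → ℂ)
    (s : Fin k) : (indicial lam Lam b s).map (φ : Olam lam →+* A) =
      localIndicial (shiftedGenF φ (b s)) (size (Lam s)) := by
  rw [indicial, localIndicial, Polynomial.map_sum]
  refine Finset.sum_congr rfl fun i _ => ?_
  rw [Polynomial.map_mul, map_C, ← map_coeffG, Polynomial.map_prod]
  simp

theorem map_matM (φ : Olam lam →ₐ[ℂ] A) (Lam : Fin k → Fin N → ℕ) (b : Fin k → ℂ) (s : Fin k) :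
    (matM lam Lam b s).map φ = expoMatrix (shiftedGenF φ (b s)) (expo (Lam s)) := by
  ext a l
  rw [shiftedGenF_eq_map, expoMatrix, Matrix.of_apply, coeff_map, Matrix.map_apply, matM,
    Matrix.of_apply]
  refine congrArg φ ?_
  rw [taylor_coeff, ← factorial_smul_hasseDeriv]
  have h : ((Nat.factorial (expo (Lam s) l) : ℂ)) ≠ 0 := by exact_mod_cast Nat.factorial_ne_zero _
  rw [LinearMap.smul_apply, eval_smul, nsmul_eq_mul, ← mul_assoc,
    ← map_natCast (MvPolynomial.C : ℂ →+* Olam lam), ← map_mul, inv_mul_cancel₀ h, map_one,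
    one_mul]

/-- The value of the leading coefficient of the indicial polynomial at `b_s`. -/
def indicialLead (lam : Fin N → ℕ) (Lam : Fin k → Fin N → ℕ) (b : Fin k → ℂ) (s : Fin k) : ℂ :=
  wrLead lam * ∏ r ∈ Finset.univ.erase s, (b s - b r) ^ size (Lam r)

theorem indicialLead_ne_zero (hlam : Antitone lam) (Lam : Fin k → Fin N → ℕ) {b : Fin k → ℂ}
    (hb : Function.Injective b) (s : Fin k) : indicialLead lam Lam b s ≠ 0 := by
  refine mul_ne_zero (Finset.prod_ne_zero_iff.mpr fun i _ => Finset.prod_ne_zero_iff.mpr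
    fun j hj => ?_) (Finset.prod_ne_zero_iff.mpr fun r hr => pow_ne_zero _ ?_)
  · rw [sub_ne_zero]
    intro h
    exact (Finset.mem_Ioi.mp hj).ne' (expo_injective hlam (by exact_mod_cast h))
  · rw [sub_ne_zero]
    exact fun h => (Finset.mem_erase.mp hr).1 (hb h).symm

theorem map_indicialTarget (φ : Olam lam →ₐ[ℂ] A) (Lam : Fin k → Fin N → ℕ) (b : Fin k → ℂ)
    (s : Fin k) : (indicialTarget lam Lam b s).map (φ : Olam lam →+* A) =
      C (algebraMap ℂ A (indicialLead lam Lam b s)) *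
        ∏ l, (X - C (expo (Lam s) l : A)) := by
  rw [indicialTarget, Polynomial.map_mul, map_C, Polynomial.map_prod, algHom_C]
  simp [indicialLead]

theorem idealI_le_ker_iff (φ : Olam lam →ₐ[ℂ] A) (Lam : Fin k → Fin N → ℕ) (b : Fin k → ℂ) :
    idealI lam Lam b ≤ RingHom.ker φ ↔ ∀ s,
      (∀ i : Fin (N + 1),
        X ^ size (Lam s) ∣ X ^ (i : ℕ) * polyG (shiftedGenF φ (b s)) i) ∧
      localIndicial (shiftedGenF φ (b s)) (size (Lam s)) =
        C (algebraMap ℂ A (indicialLead lam Lam b s)) * ∏ l, (X - C (expo (Lam s) l : A)) := by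
  rw [idealI, Ideal.span_le, Set.union_subset_iff]
  constructor
  · rintro ⟨h1, h2⟩ s
    refine ⟨fun i => ?_, ?_⟩
    · rw [X_pow_dvd_iff]
      intro n hn
      rw [← map_coeffG]
      by_cases h : (i : ℕ) ≤ n
      · exact h1 ⟨s, i, (n : ℤ) - (i : ℕ), by omega, by omega, rfl⟩
      · rw [coeffG, if_neg (by omega), map_zero]
    · rw [← map_indicial, ← map_indicialTarget, ← sub_eq_zero, ← Polynomial.map_sub]
      ext m
      rw [coeff_map, coeff_zero]
      exact h2 ⟨s, m, rfl⟩
  · intro h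
    constructor
    · rintro _ ⟨s, i, j, hj, hj', rfl⟩
      obtain ⟨m, rfl⟩ := Int.eq_ofNat_of_zero_le hj
      have h1 := X_pow_dvd_iff.mp ((h s).1 i) (m + i) (by omega)
      rw [← map_coeffG] at h1
      simpa using h1
    · rintro _ ⟨s, m, rfl⟩
      have h1 := (h s).2
      rw [← map_indicial, ← map_indicialTarget, ← sub_eq_zero, ← Polynomial.map_sub] at h1
      have h2 : ((indicial lam Lam b s - indicialTarget lam Lam b s).map
        (φ : Olam lam →+* A)).coeff m = (0 : A[X]).coeff m := by rw [h1]
      rw [coeff_map, coeff_zero] at h2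
      exact h2

/-- The specialization `φ` of the coordinates satisfies the equations of the Schubert cells
at the points `b_s`: the span of the specialized `f_i(u)` has a basis with the prescribed
orders at `b_s`, normalized at the exponents. -/
def SatisfiesCells (φ : Olam lam →ₐ[ℂ] A) (Lam : Fin k → Fin N → ℕ) (b : Fin k → ℂ) : Prop :=
  ∀ s, ∃ B : Matrix (Fin N) (Fin N) A, B * (matM lam Lam b s).map φ = 1 ∧
    ∀ i, X ^ expo (Lam s) i ∣ ∑ m, C (B i m) * shiftedGenF φ (b s) m

theorem natDegree_map_genF_le (φ : Olam lam →ₐ[ℂ] A) (a : Fin N) :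
    ((genF lam a).map (φ : Olam lam →+* A)).natDegree ≤ expo lam a :=
  natDegree_map_le.trans (natDegree_genF_le a)

theorem coeff_map_genF_expo (φ : Olam lam →ₐ[ℂ] A) (a : Fin N) :
    ((genF lam a).map (φ : Olam lam →+* A)).coeff (expo lam a) = 1 := by
  rw [coeff_map, coeff_genF_expo, map_one]

/-- Frobenius' method applies because the prescribed leading coefficient is a nonzero complex
number: the `d_i` and the `b_s` are distinct. -/
theorem satisfiesCells_of_idealI_le_ker (hlam : Antitone lam) (φ : Olam lam →ₐ[ℂ] A)
    (Lam : Fin k → Fin N → ℕ) {b : Fin k → ℂ} (hb : Function.Injective b)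
    (h : idealI lam Lam b ≤ RingHom.ker φ) : SatisfiesCells φ Lam b := by
  rw [idealI_le_ker_iff] at h
  intro s
  obtain ⟨h1, h2⟩ := h s
  have hc := (IsUnit.mk0 _ (indicialLead_ne_zero hlam Lam hb s)).map (algebraMap ℂ A)
  have hu : IsUnit (expoMatrix (shiftedGenF φ (b s)) (expo (Lam s))).det :=
    isUnit_det_expoMatrix _ _ (expo lam) (expo_injective hlam) (natDegree_map_genF_le φ)
      (coeff_map_genF_expo φ) _ _ h1 _ hc h2
  rw [map_matM]
  refine ⟨_, Matrix.nonsing_inv_mul _ hu, ?_⟩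
  exact X_pow_dvd_of_mul_expoMatrix_eq_one _ _ _ h1 _ hc h2 _ (Matrix.nonsing_inv_mul _ hu)

/-- The local equations fix the indicial polynomials up to a constant. That constant comes from the
Wronskian, whose zeros at the `b_s` exhaust its degree because `∑ n_s = n`. -/
theorem idealI_le_ker_of_satisfiesCells (φ : Olam lam →ₐ[ℂ] A)
    (Lam : Fin k → Fin N → ℕ) {b : Fin k → ℂ} (hb : Function.Injective b)
    (hsize : ∑ s, size (Lam s) = size lam)
    (h : SatisfiesCells φ Lam b) : idealI lam Lam b ≤ RingHom.ker φ := by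
  rw [idealI_le_ker_iff]
  have hloc : ∀ s, (∀ i : Fin (N + 1),
        X ^ size (Lam s) ∣ X ^ (i : ℕ) * polyG (shiftedGenF φ (b s)) i) ∧
      localIndicial (shiftedGenF φ (b s)) (size (Lam s)) =
        C ((polyG (shiftedGenF φ (b s)) 0).coeff (size (Lam s))) *
          ∏ l, (X - C (expo (Lam s) l : A)) := fun s => by
    obtain ⟨B, hB, hg⟩ := h s
    rw [map_matM] at hB
    exact X_pow_dvd_polyG_and_localIndicial (shiftedGenF φ (b s)) _ _ (size_add_sum (Lam s)) B hB hg
  obtain ⟨hW1, hW2⟩ := natDegree_polyG_zero_le_and_coeff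
    (fun a => (genF lam a).map (φ : Olam lam →+* A)) (expo lam) (natDegree_map_genF_le φ)
    (coeff_map_genF_expo φ) _ (size_add_sum lam)
  rw [← hsize] at hW1 hW2
  have hWs : ∀ s, polyG (shiftedGenF φ (b s)) 0 = taylor (algebraMap ℂ A (b s))
      (polyG (fun a => (genF lam a).map (φ : Olam lam →+* A)) 0) := fun s => polyG_taylor _ _ _
  have hlead := coeff_taylor_of_X_pow_dvd_taylor b hb (fun s => size (Lam s)) _ hW1 fun s => by
    rw [← hWs]
    simpa using (hloc s).1 0
  intro s
  refine ⟨(hloc s).1, ?_⟩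
  rw [(hloc s).2, hWs, hlead, hW2]
  congr 2
  simp [indicialLead, wrLead]

end Global

/-! ### Complex points and Schubert cells -/

section Points

variable {N k : ℕ} {lam : Fin N → ℕ}

theorem expo_le_iff {mu : Fin N → ℕ} (h : Antitone mu) (i j : Fin N) :
    expo mu i ≤ expo mu j ↔ j ≤ i := by
  have key : ∀ i j : Fin N, i < j → expo mu j < expo mu i := by
    intro i j hij
    have := h hij.le
    rw [Fin.lt_def] at hij
    unfold expo
    omega
  constructor
  · intro hle
    by_contra hlt
    exact absurd (key i j (not_le.mp hlt)) (by omega)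
  · intro hji
    rcases hji.lt_or_eq with h1 | rfl
    · exact (key _ _ h1).le
    · exact le_rfl

/-- The dimension of the intersection of a subspace with a member of a filtration to which a basis
of the subspace is adapted. -/
theorem finrank_span_inf_eq_card {V : Type*} [AddCommGroup V] [Module ℂ V] (h : Fin N → V)
    (hli : LinearIndependent ℂ h) (W : Submodule ℂ V) (T : Finset (Fin N))
    (h1 : ∀ i ∈ T, h i ∈ W)
    (h2 : ∀ v : Fin N → ℂ, ∑ i, v i • h i ∈ W → ∀ i, i ∉ T → v i = 0) :
    Module.finrank ℂ (Submodule.span ℂ (Set.range h) ⊓ W : Submodule ℂ V) = T.card := by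
  classical
  have h3 : Submodule.span ℂ (Set.range h) ⊓ W =
      Submodule.span ℂ (Set.range fun i : T => h i) := by
    apply le_antisymm
    · rintro p ⟨hp, hpW⟩
      obtain ⟨v, rfl⟩ := (Submodule.mem_span_range_iff_exists_fun ℂ).mp hp
      refine Submodule.sum_mem _ fun i _ => ?_
      by_cases hi : i ∈ T
      · exact Submodule.smul_mem _ _ (Submodule.subset_span ⟨⟨i, hi⟩, rfl⟩)
      · rw [h2 v hpW i hi, zero_smul]
        exact Submodule.zero_mem _
    · rw [Submodule.span_le]
      rintro _ ⟨i, rfl⟩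
      exact ⟨Submodule.subset_span ⟨i, rfl⟩, h1 i i.2⟩
  rw [h3]
  exact (finrank_span_eq_card (hli.comp _ Subtype.val_injective)).trans (Fintype.card_coe T)

/-- The specialization of `f_a(u)` at the point with coordinates `x`. -/
noncomputable def polyAt (x : CoordIdx lam → ℂ) (a : Fin N) : ℂ[X] :=
  (genF lam a).map (MvPolynomial.eval x)

theorem shiftedGenF_aeval (x : CoordIdx lam → ℂ) (z : ℂ) (a : Fin N) :
    shiftedGenF (MvPolynomial.aeval x : Olam lam →ₐ[ℂ] ℂ) z a = taylor z (polyAt x a) := rfl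

theorem spaceAt_eq_span_polyAt (x : CoordIdx lam → ℂ) :
    spaceAt lam x = Submodule.span ℂ (Set.range (polyAt x)) := rfl

theorem natDegree_polyAt_le (x : CoordIdx lam → ℂ) (a : Fin N) :
    (polyAt x a).natDegree ≤ expo lam a :=
  natDegree_map_genF_le (MvPolynomial.aeval x : Olam lam →ₐ[ℂ] ℂ) a

theorem coeff_polyAt_expo (x : CoordIdx lam → ℂ) (a : Fin N) :
    (polyAt x a).coeff (expo lam a) = 1 :=
  coeff_map_genF_expo (MvPolynomial.aeval x : Olam lam →ₐ[ℂ] ℂ) a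

theorem linearIndependent_polyAt (hlam : Antitone lam) (x : CoordIdx lam → ℂ) :
    LinearIndependent ℂ (polyAt x) := by
  rw [Fintype.linearIndependent_iff]
  intro v hv
  exact congrFun (eq_zero_of_sum_C_mul_eq_zero (polyAt x) (expo lam) (expo_injective hlam)
    (natDegree_polyAt_le x) (coeff_polyAt_expo x) v (by simpa [smul_eq_C_mul] using hv))

theorem polyAt_mem_degreeLT {x : CoordIdx lam → ℂ} {a : Fin N} {m : ℕ} (h : expo lam a < m) :
    polyAt x a ∈ degreeLT ℂ m := by
  rw [mem_degreeLT]
  exact (degree_le_of_natDegree_le (natDegree_polyAt_le x a)).trans_lt (by exact_mod_cast h)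

theorem finrank_spaceAt_inf_flagInfty (hlam : Antitone lam) (x : CoordIdx lam → ℂ) (m : ℕ) :
    Module.finrank ℂ (spaceAt lam x ⊓ flagInfty m : Submodule ℂ ℂ[X]) =
      (Finset.univ.filter fun a => expo lam a < m).card := by
  refine finrank_span_inf_eq_card _ (linearIndependent_polyAt hlam x) _ _ (fun a ha => ?_)
    fun v hv a ha => ?_
  · exact polyAt_mem_degreeLT (Finset.mem_filter.mp ha).2
  · refine eq_zero_of_coeff_sum_C_mul_eq_zero (polyAt x) (expo lam) (expo_injective hlam)
      (natDegree_polyAt_le x) (coeff_polyAt_expo x) v m (fun j hj => ?_) a (by simpa using ha)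
    simp only [smul_eq_C_mul] at hv
    rw [flagInfty, mem_degreeLT] at hv
    exact coeff_eq_zero_of_degree_lt (hv.trans_le (by exact_mod_cast hj))

theorem card_filter_expo_lt_succ {mu : Fin N → ℕ} (hmu : Antitone mu) (j : Fin N) :
    (Finset.univ.filter fun a => expo mu a < expo mu j + 1).card = N - j := by
  rw [← Fin.card_Ici]
  congr 1
  ext a
  simp [expo_le_iff hmu]

theorem card_filter_expo_lt {mu : Fin N → ℕ} (hmu : Antitone mu) (j : Fin N) :
    (Finset.univ.filter fun a => expo mu a < expo mu j).card = N - 1 - j := by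
  rw [← Fin.card_Ioi]
  congr 1
  ext a
  simp only [Finset.mem_filter, Finset.mem_univ, true_and, Finset.mem_Ioi]
  rw [← not_le, expo_le_iff hmu, not_le]

theorem card_filter_le_expo {mu : Fin N → ℕ} (hmu : Antitone mu) (j : Fin N) :
    (Finset.univ.filter fun a => expo mu j ≤ expo mu a).card = j + 1 := by
  rw [← Fin.card_Iic]
  congr 1
  ext a
  simp [expo_le_iff hmu]

theorem card_filter_lt_expo {mu : Fin N → ℕ} (hmu : Antitone mu) (j : Fin N) :
    (Finset.univ.filter fun a => expo mu j + 1 ≤ expo mu a).card = j := by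
  rw [← Fin.card_Iio]
  congr 1
  ext a
  simp only [Finset.mem_filter, Finset.mem_univ, true_and, Finset.mem_Iio, Nat.succ_le_iff]
  rw [← not_le, expo_le_iff hmu, not_le]

theorem expo_lt_of_le {d : ℕ} (hNd : N ≤ d) (hlamd : ∀ i, lam i ≤ d - N) (a : Fin N) :
    expo lam a < d := by
  have := hlamd a
  unfold expo
  omega

theorem spaceAt_le_degreeLT {d : ℕ} (hNd : N ≤ d) (hlamd : ∀ i, lam i ≤ d - N)
    (x : CoordIdx lam → ℂ) : spaceAt lam x ≤ degreeLT ℂ d := by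
  rw [spaceAt_eq_span_polyAt, Submodule.span_le]
  rintro _ ⟨a, rfl⟩
  exact polyAt_mem_degreeLT (expo_lt_of_le hNd hlamd a)

theorem finrank_spaceAt (hlam : Antitone lam) (x : CoordIdx lam → ℂ) :
    Module.finrank ℂ (spaceAt lam x) = N := by
  rw [spaceAt_eq_span_polyAt, finrank_span_eq_card (linearIndependent_polyAt hlam x),
    Fintype.card_fin]

theorem spaceAt_mem_schubertCell_flagInfty {d : ℕ} (hNd : N ≤ d) (hlam : Antitone lam)
    (hlamd : ∀ i, lam i ≤ d - N) (x : CoordIdx lam → ℂ) :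
    spaceAt lam x ∈ schubertCell N d flagInfty (dualPartition d lam) := by
  refine ⟨spaceAt_le_degreeLT hNd hlamd x, finrank_spaceAt hlam x, fun j => ?_⟩
  have h1 := hlamd j.rev
  have hr : ((j.rev : Fin N) : ℕ) = N - 1 - j := by rw [Fin.val_rev]; omega
  have h2 : d - N + (j + 1) - dualPartition d lam j = expo lam j.rev + 1 := by
    unfold dualPartition expo
    omega
  rw [h2, Nat.add_sub_cancel, finrank_spaceAt_inf_flagInfty hlam,
    finrank_spaceAt_inf_flagInfty hlam, card_filter_expo_lt_succ hlam, card_filter_expo_lt hlam]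
  omega

theorem X_sub_C_pow_dvd_iff_X_pow_dvd_taylor (z : ℂ) (e : ℕ) (p : ℂ[X]) :
    (X - C z) ^ e ∣ p ↔ X ^ e ∣ taylor z p := by
  have h : ∀ q : ℂ[X], taylorEquiv z q = taylor z q := fun _ => rfl
  rw [← map_dvd_iff (taylorEquiv z), map_pow, h, h, map_sub, taylor_X, taylor_C,
    add_sub_cancel_right]

theorem mem_flagAt_iff {d m : ℕ} (hm : m ≤ d) (z : ℂ) (p : ℂ[X]) :
    p ∈ flagAt d z m ↔ p ∈ degreeLT ℂ d ∧ (X - C z) ^ (d - m) ∣ p := by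
  have hdeg : ∀ q : ℂ[X], (X - C z) ^ (d - m) * q ∈ degreeLT ℂ d ↔ q ∈ degreeLT ℂ m := by
    intro q
    rw [mem_degreeLT, mem_degreeLT]
    by_cases hq : q = 0
    · simp [hq]
    · rw [degree_eq_natDegree (mul_ne_zero (pow_ne_zero _ (X_sub_C_ne_zero z)) hq),
        degree_eq_natDegree hq, ((monic_X_sub_C z).pow _).natDegree_mul' hq,
        (monic_X_sub_C z).natDegree_pow, natDegree_X_sub_C, Nat.cast_lt, Nat.cast_lt]
      omega
  rw [flagAt, Submodule.mem_map]
  constructor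
  · rintro ⟨q, hq, rfl⟩
    exact ⟨(hdeg q).mpr hq, q, rfl⟩
  · rintro ⟨hp, q, rfl⟩
    exact ⟨q, (hdeg q).mp hp, rfl⟩

/-- Taking the coefficient at `e l` recovers the `l`-th coordinate; this gives both independence and
adaptedness of the basis to the flag. -/
theorem finrank_inf_flagAt {d m : ℕ} (hm : m ≤ d) (z : ℂ) (e : Fin N → ℕ) (g : Fin N → ℂ[X])
    (hgd : ∀ i, g i ∈ degreeLT ℂ d) (hg : ∀ i, X ^ e i ∣ taylor z (g i))
    (hge : ∀ i l, (taylor z (g i)).coeff (e l) = if i = l then 1 else 0) :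
    Module.finrank ℂ (Submodule.span ℂ (Set.range g) ⊓ flagAt d z m : Submodule ℂ ℂ[X]) =
      (Finset.univ.filter fun i => d - m ≤ e i).card := by
  have hsum : ∀ (v : Fin N → ℂ) l, (taylor z (∑ i, v i • g i)).coeff (e l) = v l := by
    intro v l
    simp [map_sum, finsetSum_coeff, hge]
  refine finrank_span_inf_eq_card g ?_ _ _ (fun i hi => ?_) fun v hv i hi => ?_
  · rw [Fintype.linearIndependent_iff]
    intro v hv l
    rw [← hsum v l, hv, map_zero, coeff_zero]
  · rw [mem_flagAt_iff hm, X_sub_C_pow_dvd_iff_X_pow_dvd_taylor]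
    exact ⟨hgd i, (pow_dvd_pow _ (Finset.mem_filter.mp hi).2).trans (hg i)⟩
  · rw [mem_flagAt_iff hm, X_sub_C_pow_dvd_iff_X_pow_dvd_taylor] at hv
    rw [← hsum v i]
    exact X_pow_dvd_iff.mp hv.2 _ (by
      simpa only [Finset.mem_filter, Finset.mem_univ, true_and, not_le] using hi)

theorem mem_Omega_of_satisfiesCells {d : ℕ} (hNd : N ≤ d) (hlam : Antitone lam)
    (hlamd : ∀ i, lam i ≤ d - N) (Lam : Fin k → Fin N → ℕ) (hLam : ∀ s, Antitone (Lam s))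
    (b : Fin k → ℂ) (x : CoordIdx lam → ℂ)
    (h : SatisfiesCells (MvPolynomial.aeval x : Olam lam →ₐ[ℂ] ℂ) Lam b) :
    x ∈ Omega d lam Lam b := by
  refine ⟨spaceAt_mem_schubertCell_flagInfty hNd hlam hlamd x, Set.mem_iInter.mpr fun s => ?_⟩
  obtain ⟨B, hB, hdvd⟩ := h s
  rw [map_matM] at hB
  set M := expoMatrix (shiftedGenF (MvPolynomial.aeval x : Olam lam →ₐ[ℂ] ℂ) (b s)) (expo (Lam s))
    with hM
  set g : Fin N → ℂ[X] := fun i => ∑ m, B i m • polyAt x m with hg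
  have htay : ∀ i, taylor (b s) (g i) = ∑ m, C (B i m) *
      shiftedGenF (MvPolynomial.aeval x : Olam lam →ₐ[ℂ] ℂ) (b s) m := by
    intro i
    simp [hg, map_sum, shiftedGenF_aeval, smul_eq_C_mul]
  have hge : ∀ i l, (taylor (b s) (g i)).coeff (expo (Lam s) l) = if i = l then 1 else 0 := by
    intro i l
    rw [htay, coeff_sum_C_mul_eq_mul_expoMatrix, hB, Matrix.one_apply]
  have hgX : ∀ i, X ^ expo (Lam s) i ∣ taylor (b s) (g i) := fun i => by
    rw [htay]; exact hdvd i
  have hgV : ∀ i, g i ∈ spaceAt lam x := fun i =>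
    Submodule.sum_mem _ fun m _ => Submodule.smul_mem _ _ (Submodule.subset_span ⟨m, rfl⟩)
  have hspan : spaceAt lam x = Submodule.span ℂ (Set.range g) := by
    apply le_antisymm
    · rw [spaceAt_eq_span_polyAt, Submodule.span_le]
      rintro _ ⟨a, rfl⟩
      have h1 : polyAt x a = ∑ i, M a i • g i := by
        have h2 : ∑ i, M a i • g i = ∑ m, (M * B) a m • polyAt x m := by
          simp only [hg, Finset.smul_sum, Matrix.mul_apply, Finset.sum_smul, smul_smul]
          rw [Finset.sum_comm]
        rw [h2, mul_eq_one_comm.mp hB]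
        simp [Matrix.one_apply]
      rw [h1]
      exact Submodule.sum_mem _ fun i _ =>
        Submodule.smul_mem _ _ (Submodule.subset_span ⟨i, rfl⟩)
    · rw [Submodule.span_le]
      rintro _ ⟨i, rfl⟩
      exact hgV i
  have hgd : ∀ i, g i ∈ degreeLT ℂ d := fun i => spaceAt_le_degreeLT hNd hlamd x (hgV i)
  refine ⟨spaceAt_le_degreeLT hNd hlamd x, finrank_spaceAt hlam x, fun j => ?_⟩
  -- This keeps the natural-number subtractions in the flag indices from truncating: `g j` has
  -- degree below `d` and coefficient 1 at its exponent.
  have hjd : expo (Lam s) j < d := by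
    by_contra hlt
    have h1 := hge j j
    rw [if_pos rfl, coeff_eq_zero_of_degree_lt] at h1
    · exact zero_ne_one h1
    · rw [degree_taylor]
      exact (mem_degreeLT.mp (hgd j)).trans_le (by exact_mod_cast not_lt.mp hlt)
  have hj := j.2
  unfold expo at hjd
  have e1 : d - (d - N + (j + 1) - Lam s j) = expo (Lam s) j := by unfold expo; omega
  have e2 : d - (d - N + (j + 1) - Lam s j - 1) = expo (Lam s) j + 1 := by unfold expo; omega
  rw [hspan, finrank_inf_flagAt (by omega) (b s) _ g hgd hgX hge,
    finrank_inf_flagAt (by omega) (b s) _ g hgd hgX hge, e1, e2]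
  exact ⟨card_filter_le_expo (hLam s) j, card_filter_lt_expo (hLam s) j⟩

/-- Each dimension jump yields an element of the space of exact order `e_j` at `b_s`. The
coefficients of these elements at the exponents form a triangular matrix with nonzero diagonal, and
`M_s` at `x` is a right factor of it. -/
theorem eval_det_matM_ne_zero {d : ℕ} (hNd : N ≤ d) (Lam : Fin k → Fin N → ℕ)
    (hLam : ∀ s, Antitone (Lam s)) (b : Fin k → ℂ) (x : CoordIdx lam → ℂ)
    (hx : x ∈ Omega d lam Lam b) (s : Fin k) :
    MvPolynomial.eval x (matM lam Lam b s).det ≠ 0 := by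
  obtain ⟨-, hx⟩ := hx
  obtain ⟨hVd, -, hV⟩ := Set.mem_iInter.mp hx s
  have hex : ∀ j : Fin N, ∃ p ∈ spaceAt lam x, X ^ expo (Lam s) j ∣ taylor (b s) p ∧
      (taylor (b s) p).coeff (expo (Lam s) j) ≠ 0 := by
    intro j
    obtain ⟨h1, h2⟩ := hV j
    have hj := j.2
    -- If the subtraction truncated to zero, the flag term would be trivial, against the required
    -- dimension `j + 1`.
    have hpos : 0 < d - N + (j + 1) - Lam s j := by
      by_contra h0
      have h0' : d - N + (j + 1) - Lam s j = 0 := by omega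
      rw [h0'] at h1
      have : flagAt d (b s) 0 = ⊥ := by
        rw [flagAt, Submodule.eq_bot_iff]
        rintro _ ⟨q, hq, rfl⟩
        have hq0 : q = 0 := by simpa [mem_degreeLT] using hq
        simp [hq0]
      rw [this, inf_bot_eq, finrank_bot] at h1
      omega
    have e1 : d - (d - N + (j + 1) - Lam s j) = expo (Lam s) j := by unfold expo; omega
    have e2 : d - (d - N + (j + 1) - Lam s j - 1) = expo (Lam s) j + 1 := by unfold expo; omega
    have hne : ¬ (spaceAt lam x ⊓ flagAt d (b s) (d - N + (j + 1) - Lam s j) ≤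
        spaceAt lam x ⊓ flagAt d (b s) (d - N + (j + 1) - Lam s j - 1)) := by
      intro hle
      have hfin : Module.Finite ℂ (spaceAt lam x ⊓
          flagAt d (b s) (d - N + (j + 1) - Lam s j - 1) : Submodule ℂ ℂ[X]) := by
        have : Module.Finite ℂ (spaceAt lam x) := by
          rw [spaceAt_eq_span_polyAt]
          exact Module.Finite.span_of_finite ℂ (Set.finite_range _)
        exact Submodule.finiteDimensional_inf_left _ _
      have := Submodule.finrank_mono hle
      omega
    obtain ⟨p, ⟨hpV, hp⟩, hp'⟩ := SetLike.not_le_iff_exists.mp hne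
    rw [SetLike.mem_coe, mem_flagAt_iff (by omega), e1, X_sub_C_pow_dvd_iff_X_pow_dvd_taylor] at hp
    refine ⟨p, hpV, hp.2, fun h0 => hp' ⟨hpV, ?_⟩⟩
    rw [SetLike.mem_coe, mem_flagAt_iff (by omega), e2, X_sub_C_pow_dvd_iff_X_pow_dvd_taylor]
    refine ⟨hp.1, X_pow_dvd_iff.mpr fun i hi => ?_⟩
    rcases Nat.lt_succ_iff_lt_or_eq.mp hi with h3 | rfl
    · exact X_pow_dvd_iff.mp hp.2 i h3
    · exact h0
  choose p hpV hpX hp0 using hex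
  have hc : ∀ j, ∃ c : Fin N → ℂ, ∑ m, c m • polyAt x m = p j := fun j =>
    (Submodule.mem_span_range_iff_exists_fun ℂ).mp (hpV j)
  choose c hc using hc
  set φ : Olam lam →ₐ[ℂ] ℂ := MvPolynomial.aeval x
  have hent : ∀ j l, (Matrix.of c * (matM lam Lam b s).map φ) j l =
      (taylor (b s) (p j)).coeff (expo (Lam s) l) := by
    intro j l
    rw [map_matM, ← coeff_sum_C_mul_eq_mul_expoMatrix, ← hc]
    congr 1
    simp [φ, map_sum, shiftedGenF_aeval, smul_eq_C_mul]
  have hdet : (Matrix.of c * (matM lam Lam b s).map φ).det ≠ 0 := by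
    rw [Matrix.det_of_isLowerTriangular]
    · exact Finset.prod_ne_zero_iff.mpr fun j _ => by rw [hent]; exact hp0 j
    · intro j l hjl
      have hjl' : j < l := hjl
      rw [hent]
      refine X_pow_dvd_iff.mp (hpX j) _ ?_
      rw [← not_le, expo_le_iff (hLam s)]
      exact not_le.mpr hjl'
  rw [Matrix.det_mul] at hdet
  have h3 : MvPolynomial.eval x (matM lam Lam b s).det = ((matM lam Lam b s).map φ).det := by
    rw [RingHom.map_det]
    rfl
  rw [h3]
  exact right_ne_zero_of_mul hdet

end Points

/-! ### Regular functions as a localization, and comparison of the quotients -/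

section Localization

variable {N k : ℕ} {lam : Fin N → ℕ}

instance finite_coordIdx (lam : Fin N → ℕ) : Finite (CoordIdx lam) := by
  refine Set.Finite.subset (s := (Set.univ : Set (Fin N)) ×ˢ Set.Iic (∑ i, expo lam i))
    (Set.finite_univ.prod (Set.finite_Iic _)) ?_
  rintro ⟨i, j⟩ ⟨-, hj, -⟩
  exact ⟨Set.mem_univ _, hj.trans
    (Finset.single_le_sum (f := expo lam) (fun _ _ => Nat.zero_le _) (Finset.mem_univ i))⟩

/-- Nullstellensatz for the ideal `I`: its zeros lie on the intersection of the cells. -/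
theorem exists_mem_Omega_of_ne_top {d : ℕ} (hNd : N ≤ d) (hlam : Antitone lam)
    (hlamd : ∀ i, lam i ≤ d - N) (Lam : Fin k → Fin N → ℕ) (hLam : ∀ s, Antitone (Lam s))
    {b : Fin k → ℂ} (hb : Function.Injective b) (K : Ideal (Olam lam))
    (hIK : idealI lam Lam b ≤ K) (hK : K ≠ ⊤) :
    ∃ x ∈ Omega d lam Lam b, ∀ p ∈ K, MvPolynomial.eval x p = 0 := by
  obtain ⟨m, hm, hKm⟩ := Ideal.exists_le_maximal K hK
  obtain ⟨x, rfl⟩ := MvPolynomial.isMaximal_iff_eq_vanishingIdeal_singleton.mp hm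
  have h1 : ∀ p ∈ K, MvPolynomial.eval x p = 0 := fun p hp =>
    (MvPolynomial.mem_vanishingIdeal_singleton_iff x p).mp (hKm hp)
  exact ⟨x, mem_Omega_of_satisfiesCells hNd hlam hlamd Lam hLam b x
    (satisfiesCells_of_idealI_le_ker hlam _ Lam hb fun p hp => h1 p (hIK hp)), h1⟩

/-- The polynomials without zeros on the intersection of the cells. -/
def denominators (d : ℕ) (lam : Fin N → ℕ) (Lam : Fin k → Fin N → ℕ) (b : Fin k → ℂ) :
    Submonoid (Olam lam) where
  carrier := {q | ∀ x ∈ Omega d lam Lam b, MvPolynomial.eval x q ≠ 0}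
  one_mem' := by intro x _; simp
  mul_mem' := by
    intro p q hp hq x hx
    simpa using ⟨hp x hx, hq x hx⟩

theorem isUnit_algebraMap_QLam (d : ℕ) (Lam : Fin k → Fin N → ℕ) (b : Fin k → ℂ)
    (q : Olam lam) (hq0 : q ≠ 0) (hq : q ∈ denominators d lam Lam b) :
    IsUnit (algebraMap (Olam lam) (QLam d lam Lam b) q) := by
  have hq' : algebraMap (Olam lam) (Qlam lam) q ≠ 0 := by
    simpa using hq0
  have hmem : (algebraMap (Olam lam) (Qlam lam) q)⁻¹ ∈ QLam d lam Lam b := fun x hx =>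
    ⟨1, q, hq x hx, by rw [map_one, inv_mul_cancel₀ hq']⟩
  refine IsUnit.of_mul_eq_one ⟨_, hmem⟩ (Subtype.ext ?_)
  exact mul_inv_cancel₀ hq'

/-- Regularity is pointwise, with a denominator depending on the point. By unique factorization the
reduced denominator divides all of them, so one fraction serves all of `Ω`. -/
theorem exists_denominator (d : ℕ) (Lam : Fin k → Fin N → ℕ) (b : Fin k → ℂ)
    (y : QLam d lam Lam b) : ∃ p q : Olam lam, q ∈ denominators d lam Lam b ∧
      y * algebraMap (Olam lam) (QLam d lam Lam b) q =
        algebraMap (Olam lam) (QLam d lam Lam b) p := by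
  obtain ⟨p, q, hpq, hy⟩ := IsFractionRing.exists_reduced_fraction (Olam lam) (y : Qlam lam)
  have hy' : (y : Qlam lam) * algebraMap (Olam lam) (Qlam lam) q =
      algebraMap (Olam lam) (Qlam lam) p := by
    rw [← hy, IsLocalization.mk'_spec]
  refine ⟨p, q, fun x hx => ?_, Subtype.ext hy'⟩
  obtain ⟨p', q', hq', hy''⟩ := y.2 x hx
  have h1 : p * q' = p' * q := by
    apply IsFractionRing.injective (Olam lam) (Qlam lam)
    rw [map_mul, map_mul, ← hy', ← hy'']
    ring
  have h2 : (q : Olam lam) ∣ q' := hpq.symm.dvd_of_dvd_mul_left ⟨p', by rw [h1, mul_comm]⟩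
  obtain ⟨r, rfl⟩ := h2
  rw [map_mul] at hq'
  exact left_ne_zero_of_mul hq'

theorem ne_zero_of_mem_denominators {d : ℕ} {Lam : Fin k → Fin N → ℕ} {b : Fin k → ℂ}
    (hne : (Omega d lam Lam b).Nonempty) {q : Olam lam} (hq : q ∈ denominators d lam Lam b) :
    q ≠ 0 := by
  obtain ⟨x, hx⟩ := hne
  rintro rfl
  exact hq x hx (map_zero _)

/-- Nonemptiness is essential: for empty `Ω` zero is a denominator, while `Q` is the whole fraction
field. -/
theorem isLocalization_QLam {d : ℕ} {Lam : Fin k → Fin N → ℕ} {b : Fin k → ℂ}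
    (hne : (Omega d lam Lam b).Nonempty) :
    IsLocalization (denominators d lam Lam b) (QLam d lam Lam b) where
  map_units q := isUnit_algebraMap_QLam d Lam b q (ne_zero_of_mem_denominators hne q.2) q.2
  surj y := by
    obtain ⟨p, q, hq, h⟩ := exists_denominator d Lam b y
    exact ⟨(p, ⟨q, hq⟩), h⟩
  exists_of_eq {p q} h := by
    refine ⟨1, ?_⟩
    have h' := congrArg (Subtype.val : QLam d lam Lam b → Qlam lam) h
    rw [IsFractionRing.injective (Olam lam) (Qlam lam) h']

variable {A : Type*} [CommRing A] [Algebra ℂ A]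

/-- The inclusion of `O_λ` into the ring of rational functions regular on the intersection. -/
noncomputable def toQLam (d : ℕ) (lam : Fin N → ℕ) (Lam : Fin k → Fin N → ℕ) (b : Fin k → ℂ) :
    Olam lam →ₐ[ℂ] QLam d lam Lam b :=
  IsScalarTower.toAlgHom ℂ (Olam lam) (QLam d lam Lam b)

theorem map_gCoeff (d : ℕ) (Lam : Fin k → Fin N → ℕ) (b : Fin k → ℂ)
    (χ : QLam d lam Lam b →ₐ[ℂ] A) (s : Fin k) (i : Fin N) (j : ℕ) :
    χ (gCoeff d lam Lam b s i j) = (∑ m, C ((matMQ d lam Lam b s)⁻¹.map χ i m) *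
      shiftedGenF (χ.comp (toQLam d lam Lam b)) (b s) m).coeff j := by
  have h1 : χ (gCoeff d lam Lam b s i j) = ((taylor (algebraMap ℂ (QLam d lam Lam b) (b s))
      (gPoly d lam Lam b s i)).map (χ : QLam d lam Lam b →+* A)).coeff j := by
    rw [coeff_map]; rfl
  have h2 : (χ : QLam d lam Lam b →+* A) (algebraMap ℂ (QLam d lam Lam b) (b s)) =
      algebraMap ℂ A (b s) := χ.commutes _
  rw [h1, map_taylor, h2, gPoly, Polynomial.map_sum, map_sum]
  congr 1
  refine Finset.sum_congr rfl fun m _ => ?_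
  rw [Polynomial.map_mul, taylor_mul, map_C, taylor_C, Polynomial.map_map]
  rfl

/-- A homomorphism kills the ideal `J` if and only if the corresponding specialization of the
coordinates satisfies the equations of the cells. -/
theorem idealJ_le_ker_iff (d : ℕ) (Lam : Fin k → Fin N → ℕ) (b : Fin k → ℂ)
    (hM : ∀ s, IsUnit (matMQ d lam Lam b s)) (χ : QLam d lam Lam b →ₐ[ℂ] A) :
    idealJ d lam Lam b ≤ RingHom.ker χ ↔
      SatisfiesCells (χ.comp (toQLam d lam Lam b)) Lam b := by
  have hinv : ∀ s, (matMQ d lam Lam b s)⁻¹.map χ *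
      (matM lam Lam b s).map (χ.comp (toQLam d lam Lam b)) = 1 := by
    intro s
    have h1 : (matM lam Lam b s).map (χ.comp (toQLam d lam Lam b)) =
        (matMQ d lam Lam b s).map χ := rfl
    rw [h1, ← Matrix.map_mul, Matrix.nonsing_inv_mul _
      ((Matrix.isUnit_iff_isUnit_det _).mp (hM s))]
    exact Matrix.map_one _ (map_zero χ) (map_one χ)
  have hgen : idealJ d lam Lam b ≤ RingHom.ker χ ↔ ∀ s i, X ^ expo (Lam s) i ∣
      ∑ m, C ((matMQ d lam Lam b s)⁻¹.map χ i m) *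
        shiftedGenF (χ.comp (toQLam d lam Lam b)) (b s) m := by
    rw [idealJ, iSup_le_iff]
    refine forall_congr' fun s => ?_
    rw [idealJs, Ideal.span_le]
    constructor
    · intro h i
      rw [X_pow_dvd_iff]
      intro j hj
      rw [← map_gCoeff]
      exact h ⟨i, j, hj, rfl⟩
    · rintro h _ ⟨i, j, hj, rfl⟩
      have := X_pow_dvd_iff.mp (h i) j hj
      rw [← map_gCoeff] at this
      exact this
  rw [hgen]
  constructor
  · exact fun h s => ⟨_, hinv s, h s⟩
  · intro h s
    obtain ⟨B, hB, hdvd⟩ := h s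
    -- Inverses are unique, so the given `B` is the image of the inverse of `M_s`.
    rwa [left_inv_eq_right_inv (hinv s) (mul_eq_one_comm.mp hB)]

theorem idealI_le_ker_of_idealJ_le_ker (d : ℕ) (Lam : Fin k → Fin N → ℕ) {b : Fin k → ℂ}
    (hb : Function.Injective b) (hsize : ∑ s, size (Lam s) = size lam)
    (hM : ∀ s, IsUnit (matMQ d lam Lam b s)) (χ : QLam d lam Lam b →ₐ[ℂ] A)
    (h : idealJ d lam Lam b ≤ RingHom.ker χ) :
    idealI lam Lam b ≤ RingHom.ker (χ.comp (toQLam d lam Lam b)) :=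
  idealI_le_ker_of_satisfiesCells _ Lam hb hsize ((idealJ_le_ker_iff d Lam b hM χ).mp h)

theorem isUnit_matMQ {d : ℕ} (hNd : N ≤ d) (Lam : Fin k → Fin N → ℕ)
    (hLam : ∀ s, Antitone (Lam s)) (b : Fin k → ℂ) (hne : (Omega d lam Lam b).Nonempty)
    (s : Fin k) : IsUnit (matMQ d lam Lam b s) := by
  rw [Matrix.isUnit_iff_isUnit_det]
  have hmem : (matM lam Lam b s).det ∈ denominators d lam Lam b := fun x hx =>
    eval_det_matM_ne_zero hNd Lam hLam b x hx s
  have h := isUnit_algebraMap_QLam d Lam b _ (ne_zero_of_mem_denominators hne hmem) hmem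
  rw [RingHom.map_det] at h
  exact h

/-- A quotient of a localization agrees with a quotient of the original ring in which the
denominators are invertible, if the homomorphisms to the quotients kill the ideals. -/
theorem nonempty_quotient_algEquiv_of_isLocalization {K : Type*} {R S : Type u} [CommRing K]
    [CommRing R] [CommRing S] [Algebra K R] [Algebra K S] [Algebra R S] [IsScalarTower K R S]
    (M : Submonoid R) [IsLocalization M S] (I : Ideal R) (J : Ideal S)
    (hM : ∀ q : M, IsUnit (Ideal.Quotient.mkₐ K I (q : R)))
    (hJ : ∀ ψ : S →ₐ[K] R ⧸ I,
      ψ.comp (IsScalarTower.toAlgHom K R S) = Ideal.Quotient.mkₐ K I → J ≤ RingHom.ker ψ)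
    (hI : ∀ (A : Type u) [CommRing A] [Algebra K A] (χ : S →ₐ[K] A), J ≤ RingHom.ker χ →
      I ≤ RingHom.ker (χ.comp (IsScalarTower.toAlgHom K R S))) :
    Nonempty ((S ⧸ J) ≃ₐ[K] (R ⧸ I)) := by
  replace hI := hI _ (Ideal.Quotient.mkₐ K J) (Ideal.Quotient.mkₐ_ker K J).ge
  -- The inverse maps are induced by `ψ` and by `R → S → S ⧸ J`; both composites are checked on `R`.
  let ψ : S →ₐ[K] R ⧸ I := IsLocalization.liftAlgHom (M := M) (f := Ideal.Quotient.mkₐ K I) hM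
  have hψ' : ∀ p, ψ (algebraMap R S p) = Ideal.Quotient.mk I p := fun p =>
    IsLocalization.lift_eq hM p
  have hψ : ψ.comp (IsScalarTower.toAlgHom K R S) = Ideal.Quotient.mkₐ K I := by
    ext p
    exact hψ' p
  refine ⟨AlgEquiv.ofAlgHom (Ideal.Quotient.liftₐ J ψ fun a ha => hJ ψ hψ ha)
    (Ideal.Quotient.liftₐ I _ fun a ha => hI ha) ?_ ?_⟩
  · refine Ideal.Quotient.algHom_ext _ ?_
    ext p
    exact hψ' p
  · refine Ideal.Quotient.algHom_ext _ ?_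
    refine AlgHom.coe_ringHom_injective (IsLocalization.ringHom_ext M ?_)
    ext p
    have h := congrArg (Ideal.Quotient.liftₐ I ((Ideal.Quotient.mkₐ K J).comp
      (IsScalarTower.toAlgHom K R S)) fun a ha => hI ha) (hψ' p)
    exact h

/-- The induced map from the zero ring `R ⧸ I` to `S ⧸ J` forces `1 = 0` in the target. No
localization is involved, so this covers empty `Ω`. -/
theorem nonempty_quotient_algEquiv_of_eq_top {K : Type*} {R S : Type u} [CommRing K]
    [CommRing R] [CommRing S] [Algebra K R] [Algebra K S] [Algebra R S] [IsScalarTower K R S]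
    (I : Ideal R) (J : Ideal S) (htop : I = ⊤)
    (hI : ∀ (A : Type u) [CommRing A] [Algebra K A] (χ : S →ₐ[K] A), J ≤ RingHom.ker χ →
      I ≤ RingHom.ker (χ.comp (IsScalarTower.toAlgHom K R S))) :
    Nonempty ((S ⧸ J) ≃ₐ[K] (R ⧸ I)) := by
  replace hI := hI _ (Ideal.Quotient.mkₐ K J) (Ideal.Quotient.mkₐ_ker K J).ge
  have hsub : Subsingleton (R ⧸ I) := Ideal.Quotient.subsingleton_iff.mpr htop
  let β := Ideal.Quotient.liftₐ I _ fun a ha => hI ha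
  have hsub' : Subsingleton (S ⧸ J) := β.toRingHom.codomain_trivial
  exact ⟨(AlgEquiv.ofBijective β ⟨Function.injective_of_subsingleton _,
    fun y => ⟨0, Subsingleton.elim _ _⟩⟩).symm⟩

theorem nonempty_algEquiv_of_nonempty {d : ℕ} (hNd : N ≤ d) (hlam : Antitone lam)
    (hlamd : ∀ i, lam i ≤ d - N) (Lam : Fin k → Fin N → ℕ) (hLam : ∀ s, Antitone (Lam s))
    (hsize : ∑ s, size (Lam s) = size lam) {b : Fin k → ℂ} (hb : Function.Injective b)
    (hne : (Omega d lam Lam b).Nonempty) :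
    Nonempty (OLam d lam Lam b ≃ₐ[ℂ] (Olam lam ⧸ idealI lam Lam b)) := by
  have hM := isUnit_matMQ hNd Lam hLam b hne
  have hloc := isLocalization_QLam hne
  have hunit : ∀ q : denominators d lam Lam b,
      IsUnit (Ideal.Quotient.mkₐ ℂ (idealI lam Lam b) (q : Olam lam)) := by
    intro q
    -- A denominator that is not invertible modulo `I` lies in a maximal ideal over `I`, hence
    -- vanishes at some point of `Ω`.
    by_contra hu
    obtain ⟨m, hm, hmem⟩ := exists_max_ideal_of_mem_nonunits hu
    obtain ⟨x, hx, hxm⟩ := exists_mem_Omega_of_ne_top hNd hlam hlamd Lam hLam hb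
      (m.comap (Ideal.Quotient.mk (idealI lam Lam b)))
      (fun p hp => by
        rw [Ideal.mem_comap, Ideal.Quotient.eq_zero_iff_mem.mpr hp]
        exact m.zero_mem)
      (Ideal.comap_ne_top _ hm.ne_top)
    exact q.2 x hx (hxm q hmem)
  refine nonempty_quotient_algEquiv_of_isLocalization (denominators d lam Lam b) _ _ hunit
    (fun ψ hψ => ?_)
    (fun A _ _ χ hχ => idealI_le_ker_of_idealJ_le_ker d Lam hb hsize hM χ hχ)
  rw [idealJ_le_ker_iff d Lam b hM]
  refine satisfiesCells_of_idealI_le_ker hlam _ Lam hb fun p hp => ?_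
  exact (congrArg (fun f : Olam lam →ₐ[ℂ] _ => f p) hψ).trans
    (Ideal.Quotient.eq_zero_iff_mem.mpr hp)

end Localization

end SchubertIntersection

theorem proposition3p3 (N d k : ℕ) (hN : 0 < N) (hNd : N ≤ d)
    (lam : Fin N → ℕ) (hlam : Antitone lam) (hlamd : ∀ i, lam i ≤ d - N)
    (Lam : Fin k → Fin N → ℕ) (hLam : ∀ s, Antitone (Lam s))
    (hsize : ∑ s, size (Lam s) = size lam)
    (b : Fin k → ℂ) (hb : Function.Injective b) :
    ((Omega d lam Lam b).Nonempty →
      (∀ s, IsUnit (matMQ d lam Lam b s)) ∧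
      Nonempty (OLam d lam Lam b ≃ₐ[ℂ] (Olam lam ⧸ idealI lam Lam b))) ∧
    (Omega d lam Lam b = ∅ →
      Subsingleton (Olam lam ⧸ idealI lam Lam b) ∧
      ((∀ s, IsUnit (matMQ d lam Lam b s)) →
        Nonempty (OLam d lam Lam b ≃ₐ[ℂ] (Olam lam ⧸ idealI lam Lam b)))) := by
  refine ⟨fun hne => ⟨isUnit_matMQ hNd Lam hLam b hne,
    nonempty_algEquiv_of_nonempty hNd hlam hlamd Lam hLam hsize hb hne⟩, fun hempty => ?_⟩
  have htop : idealI lam Lam b = ⊤ := by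
    by_contra hI
    obtain ⟨x, hx, -⟩ := exists_mem_Omega_of_ne_top hNd hlam hlamd Lam hLam hb _ le_rfl hI
    rw [hempty] at hx
    exact hx
  have hsub : Subsingleton (Olam lam ⧸ idealI lam Lam b) :=
    Ideal.Quotient.subsingleton_iff.mpr htop
  exact ⟨hsub, fun hM => nonempty_quotient_algEquiv_of_eq_top _ _ htop
    fun A _ _ χ hχ => idealI_le_ker_of_idealJ_le_ker d Lam hb hsize hM χ hχ⟩
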